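/- **Conventions.** All Hilbert spaces are complex, $\otimes$ is the completed tensor product, $\Sigma$ is the tensor flip, leg numbering notation is used, and $\mathfrak{Hilb}$ is the symmetric monoidal category of Hilbert spaces and bounded operators. **Braided multiplicative unitaries.** Let $\mathcal H\neq 0$ and $\mathcal L$ be Hilbert spaces and let $\mathbb W\in\mathcal U(\mathcal H\otimes\mathcal H)$ be a multiplicative unitary, that is, $\mathbb W_{23}\mathbb W_{12}=\mathbb W_{12}\mathbb W_{13}\mathbb W_{23}$. A right representation of $\mathbb W$ on $\mathcal K$ is $S\in\mathcal U(\mathcal K\otimes\mathcal H)$ with $\mathbb W_{23}S_{12}=S_{12}S_{13}\mathbb W_{23}$; a left representation of $\mathbb W$ on $\mathcal K$ is $V\in\mathcal U(\mathcal H\otimes\mathcal K)$ with $V_{23}\mathbb W_{12}=\mathbb W_{12}V_{13}V_{23}$. Given a left representation $V$ on $\mathcal L$ and a right representation $S$ on $\mathcal K$, the braiding operator $c_{\mathcal L,\mathcal K}\colon\mathcal L\otimes\mathcal K\to\mathcal K\otimes\mathcal L$ is $Z\Sigma$ for the unique $Z\in\mathcal U(\mathcal K\otimes\mathcal L)$ with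 $Z_{13}=V_{23}S_{12}^*V_{23}^*S_{12}$ in $\mathcal U(\mathcal K\otimes\mathcal H\otimes\mathcal L)$, provided that such a $Z$ exists (then it is unique). A braided multiplicative unitary over $\mathbb W$ consists of a right representation $U\in\mathcal U(\mathcal L\otimes\mathcal H)$ and a left representation $V\in\mathcal U(\mathcal H\otimes\mathcal L)$ of $\mathbb W$ on $\mathcal L$ and of $F\in\mathcal U(\mathcal L\otimes\mathcal L)$ such that $c_{\mathcal L,\mathcal L}$ (formed with $S=U$) exists and $$U_{23}\mathbb W_{13}V_{12}=V_{12}\mathbb W_{13}U_{23}\ \text{ on }\mathcal H\otimes\mathcal L\otimes\mathcal H,$$ $$U_{13}U_{23}F_{12}=F_{12}U_{13}U_{23}\ \text{ on }\mathcal L\otimes\mathcal L\otimes\mathcal H,\qquad V_{13}V_{12}F_{23}=F_{23}V_{13}V_{12}\ \text{ on }\mathcal H\otimes\mathcal L\otimes\mathcal L,$$ $$F_{23}F_{12}=F_{12}(c_{\mathcal L,\mathcal L})_{23}F_{12}(c_{\mathcal L,\mathcal L}^{-1})_{23}F_{23}\ \text{ on }\mathcal L\otimes\mathcal L\otimes\mathcal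 L.$$ **Representations.** A representation of $(\mathbb W,U,V,F)$ is a triple $(\mathcal K,S,T)$ where $S\in\mathcal U(\mathcal K\otimes\mathcal H)$ is a right representation of $\mathbb W$ for which the braiding operator $c_{\mathcal L,\mathcal K}$ exists, and $T\in\mathcal U(\mathcal K\otimes\mathcal L)$ satisfies $$S_{13}U_{23}T_{12}=T_{12}S_{13}U_{23}\ \text{ on }\mathcal K\otimes\mathcal L\otimes\mathcal H,\qquad F_{23}T_{12}=T_{12}(c_{\mathcal L,\mathcal L})_{23}T_{12}(c_{\mathcal L,\mathcal L}^{-1})_{23}F_{23}\ \text{ on }\mathcal K\otimes\mathcal L\otimes\mathcal L.$$ An arrow $(\mathcal K^1,S^1,T^1)\to(\mathcal K^2,S^2,T^2)$ is a bounded operator $a\colon\mathcal K^1\to\mathcal K^2$ with $a_1S^1=S^2a_1$ and $a_1T^1=T^2a_1$. Let $\mathfrak{For}(\mathcal K,S,T)=\mathcal K$ and $\tau(\mathcal K)=(\mathcal K,1,1)$, both acting identically on arrows, and let $$(\mathcal K^1,S^1,T^1)\otimes(\mathcal K^2,S^2,T^2)=\bigl(\mathcal K^1\otimes\mathcal K^2,\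 S^1_{13}S^2_{23},\ (c_{\mathcal L,\mathcal K^2})_{23}\,T^1_{12}\,(c_{\mathcal L,\mathcal K^2}^{-1})_{23}\,T^2_{23}\bigr).$$ **Statement.** With these definitions, the representations of $(\mathbb W,U,V,F)$ form a Hilbert space tensor category. That is: 1. The tensor product of two representations is again a representation, and $\otimes$ on objects extends to a monoidal category structure for which $\mathfrak{For}$ and $\tau$ are strict monoidal functors: they map tensor products of objects and arrows, the unit object, associators and unit transformations to the corresponding ones. In particular, $\tau(\mathbb C)$ is the tensor unit, the tensor product of arrows is the usual one, and $\otimes$ is associative through the usual associators of Hilbert spaces. 2. The functor $\mathfrak{For}$ is faithful, and it makes the category a $\mathrm W^*$-category: for all objects $x,y$ the arrows $x\to y$ form a linear subspace of $\mathbb B(\mathfrak{For}(x),\mathfrak{For}(y))$ that is closed in the weak operator topology, and adjoints of arrows are arrows. Moreover, $\mathfrak{For}\circ\tau=\mathrm{id}_{\mathfrak{Hilb}}$. 3. If $\mathfrak{For}(x)=\mathfrak{For}(x')$ and the identity operator on this Hilbert space is an arrow $x\to x'$, then $x=x'$. 4. If $a\colon\mathfrak{For}(x_1)\to\mathfrak{For}(x_2)$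 is a bounded operator and $y$ is an object with $\mathfrak{For}(y)\neq0$ such that $a\otimes\mathrm{id}$ is an arrow $x_1\otimes y\to x_2\otimes y$ or $\mathrm{id}\otimes a$ is an arrow $y\otimes x_1\to y\otimes x_2$, then $a$ is an arrow $x_1\to x_2$. -/

import Mathlib

open CategoryTheory MonoidalCategory UniformSpace
open scoped TensorProduct

universe u

/-- The category of complex Hilbert spaces. -/
structure Hilb : Type (u + 1) where
  carrier : Type u
  [normedAddCommGroup : NormedAddCommGroup carrier]
  [innerProductSpace : InnerProductSpace ℂ carrier]
  [completeSpace : CompleteSpace carrier]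

namespace Hilb

instance : CoeSort Hilb.{u} (Type u) := ⟨Hilb.carrier⟩

attribute [instance] normedAddCommGroup innerProductSpace completeSpace

/-- Morphisms of Hilbert spaces are the bounded linear operators. -/
@[ext]
structure Hom (A B : Hilb.{u}) where
  clm : A →L[ℂ] B

instance : Category Hilb.{u} where
  Hom A B := Hom A B
  id A := ⟨ContinuousLinearMap.id ℂ A⟩
  comp f g := ⟨g.clm.comp f.clm⟩

@[ext]
theorem hom_ext {A B : Hilb.{u}} {f g : A ⟶ B} (h : ∀ x, f.clm x = g.clm x) : f = g :=
  Hom.ext (ContinuousLinearMap.ext h)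

@[simp]
theorem id_clm (A : Hilb.{u}) : Hom.clm (𝟙 A) = ContinuousLinearMap.id ℂ A := rfl

@[simp]
theorem comp_clm {A B C : Hilb.{u}} (f : A ⟶ B) (g : B ⟶ C) :
    (f ≫ g).clm = g.clm.comp f.clm := rfl

/-- A surjective linear isometry as an isomorphism in the category of Hilbert spaces. -/
noncomputable def isoOfIsometry {A B : Hilb.{u}} (e : A ≃ₗᵢ[ℂ] B) : A ≅ B where
  hom := ⟨e.toContinuousLinearEquiv.toContinuousLinearMap⟩
  inv := ⟨e.symm.toContinuousLinearEquiv.toContinuousLinearMap⟩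
  hom_inv_id := by ext x; exact e.symm_apply_apply x
  inv_hom_id := by ext x; exact e.apply_symm_apply x

/-- The adjoint operator. -/
noncomputable def dag {A B : Hilb.{u}} (f : A ⟶ B) : B ⟶ A :=
  ⟨ContinuousLinearMap.adjoint f.clm⟩

/-- Unitary operators between Hilbert spaces. -/
structure IsUnitary {A B : Hilb.{u}} (f : A ⟶ B) : Prop where
  comp_dag : f ≫ dag f = 𝟙 A
  dag_comp : dag f ≫ f = 𝟙 B

section Unbundled

variable {E F E' F' : Type*} [NormedAddCommGroup E] [InnerProductSpace ℂ E]
  [NormedAddCommGroup F] [InnerProductSpace ℂ F]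
  [NormedAddCommGroup E'] [InnerProductSpace ℂ E'] [NormedAddCommGroup F'] [InnerProductSpace ℂ F']

theorem denseRange_mapIsometry (f : E →ₗᵢ[ℂ] E') (g : F →ₗᵢ[ℂ] F') (hf : DenseRange f)
    (hg : DenseRange g) : DenseRange (TensorProduct.mapIsometry f g) := by
  have key : (LinearMap.range (TensorProduct.mapIsometry f g).toLinearMap).topologicalClosure
      = ⊤ := by
    rw [eq_top_iff, ← TensorProduct.span_tmul_eq_top, Submodule.span_le]
    rintro _ ⟨x, y, rfl⟩
    have h1 : (x, y) ∈ closure (Set.range (Prod.map f g)) := (hf.prodMap hg) (x, y)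
    have h2 := map_mem_closure (TensorProduct.continuous_tmul (𝕜 := ℂ) (E := E') (F := F')) h1
      (t := (LinearMap.range (TensorProduct.mapIsometry f g).toLinearMap : Set (E' ⊗[ℂ] F'))) (by
        rintro _ ⟨⟨a, b⟩, rfl⟩
        exact ⟨a ⊗ₜ b, rfl⟩)
    exact h2
  intro x
  have : x ∈ (LinearMap.range (TensorProduct.mapIsometry f g).toLinearMap).topologicalClosure := by
    rw [key]; trivial
  exact this

end Unbundled

/-- The Hilbert space tensor product: the completion of the algebraic tensor product. -/
noncomputable def tensor (A B : Hilb.{u}) : Hilb.{u} := ⟨Completion (A ⊗[ℂ] B)⟩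

/-- The dense inclusion of the algebraic tensor product. -/
noncomputable def incl (A B : Hilb.{u}) : A ⊗[ℂ] B →ₗᵢ[ℂ] tensor A B :=
  Completion.toComplₗᵢ

theorem denseRange_incl (A B : Hilb.{u}) : DenseRange (incl A B) :=
  Completion.denseRange_coe

/-- The dense inclusion of the algebraic triple tensor product, bracketed to the left. -/
noncomputable def inclL (A B C : Hilb.{u}) : (A ⊗[ℂ] B) ⊗[ℂ] C →ₗᵢ[ℂ] tensor (tensor A B) C :=
  (incl (tensor A B) C).comp
    (TensorProduct.mapIsometry (incl A B) (LinearIsometry.id (R := ℂ) (E := C)))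

/-- The dense inclusion of the algebraic triple tensor product, bracketed to the right. -/
noncomputable def inclR (A B C : Hilb.{u}) : A ⊗[ℂ] (B ⊗[ℂ] C) →ₗᵢ[ℂ] tensor A (tensor B C) :=
  (incl A (tensor B C)).comp
    (TensorProduct.mapIsometry (LinearIsometry.id (R := ℂ) (E := A)) (incl B C))

theorem denseRange_inclL (A B C : Hilb.{u}) : DenseRange (inclL A B C) :=
  (denseRange_incl (tensor A B) C).comp (denseRange_mapIsometry (incl A B)
    (LinearIsometry.id (R := ℂ) (E := C)) (denseRange_incl A B)
    Function.surjective_id.denseRange) (incl (tensor A B) C).continuous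

theorem denseRange_inclR (A B C : Hilb.{u}) : DenseRange (inclR A B C) :=
  (denseRange_incl A (tensor B C)).comp (denseRange_mapIsometry
    (LinearIsometry.id (R := ℂ) (E := A)) (incl B C) Function.surjective_id.denseRange
    (denseRange_incl B C)) (incl A (tensor B C)).continuous

theorem norm_inclR_assoc (A B C : Hilb.{u}) (x : (A ⊗[ℂ] B) ⊗[ℂ] C) :
    ‖(inclR A B C).toLinearMap (TensorProduct.assoc ℂ A B C x)‖ =
      ‖(inclL A B C).toLinearMap x‖ :=
  ((inclR A B C).norm_map _).trans
    ((TensorProduct.norm_assoc x).trans ((inclL A B C).norm_map x).symm)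

/-- The associator, which extends `(a ⊗ b) ⊗ c ↦ a ⊗ (b ⊗ c)`. -/
noncomputable def assoc (A B C : Hilb.{u}) : tensor (tensor A B) C ≅ tensor A (tensor B C) :=
  isoOfIsometry ((TensorProduct.assoc ℂ A B C).extendOfIsometry (inclL A B C).toLinearMap
    (inclR A B C).toLinearMap (denseRange_inclL A B C) (denseRange_inclR A B C)
    (norm_inclR_assoc A B C))

theorem norm_incl_comm (A B : Hilb.{u}) (x : A ⊗[ℂ] B) :
    ‖(incl B A).toLinearMap (TensorProduct.comm ℂ A B x)‖ = ‖(incl A B).toLinearMap x‖ :=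
  ((incl B A).norm_map _).trans ((TensorProduct.norm_comm x).trans ((incl A B).norm_map x).symm)

/-- The flip `Σ`, which extends `a ⊗ b ↦ b ⊗ a`. -/
noncomputable def flip (A B : Hilb.{u}) : tensor A B ≅ tensor B A :=
  isoOfIsometry ((TensorProduct.comm ℂ A B).extendOfIsometry (incl A B).toLinearMap
    (incl B A).toLinearMap (denseRange_incl A B) (denseRange_incl B A) (norm_incl_comm A B))

/-- Elementary tensors. -/
noncomputable def tmul {A B : Hilb.{u}} (a : A) (b : B) : tensor A B :=
  incl A B (a ⊗ₜ b)

/-- Elementary tensors as a continuous bilinear map. -/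
noncomputable def tmulL (A B : Hilb.{u}) : A →L[ℂ] B →L[ℂ] tensor A B :=
  (ContinuousLinearMap.compL ℂ B (A ⊗[ℂ] B) (tensor A B) (incl A B).toContinuousLinearMap).comp
    (TensorProduct.mkL ℂ A B)

theorem tmulL_apply {A B : Hilb.{u}} (a : A) (b : B) : tmulL A B a b = tmul a b := rfl

theorem clm_ext {A B : Hilb.{u}} {X : Type*} [NormedAddCommGroup X] [NormedSpace ℂ X]
    {f g : tensor A B →L[ℂ] X} (h : ∀ a b, f (tmul a b) = g (tmul a b)) : f = g := by
  have h1 : f.comp (Completion.toComplL (𝕜 := ℂ) (E := A ⊗[ℂ] B)) =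
      g.comp (Completion.toComplL (𝕜 := ℂ) (E := A ⊗[ℂ] B)) := by
    apply ContinuousLinearMap.coe_injective
    apply TensorProduct.ext'
    exact h
  ext x
  refine Completion.induction_on (p := fun x => f x = g x) x
    (isClosed_eq f.continuous g.continuous) (fun a => ?_)
  exact DFunLike.congr_fun h1 a

theorem tensor_ext {A B X : Hilb.{u}} {f g : tensor A B ⟶ X}
    (h : ∀ a b, f.clm (tmul a b) = g.clm (tmul a b)) : f = g :=
  Hom.ext (clm_ext h)

theorem tensor_ext_left {A B C X : Hilb.{u}} {f g : tensor (tensor A B) C ⟶ X}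
    (h : ∀ a b c, f.clm (tmul (tmul a b) c) = g.clm (tmul (tmul a b) c)) : f = g := by
  refine tensor_ext fun x c => ?_
  exact DFunLike.congr_fun (clm_ext (f := f.clm.comp ((tmulL (tensor A B) C).flip c))
    (g := g.clm.comp ((tmulL (tensor A B) C).flip c)) (fun a b => h a b c)) x

theorem tensor_ext_right {A B C X : Hilb.{u}} {f g : tensor A (tensor B C) ⟶ X}
    (h : ∀ a b c, f.clm (tmul a (tmul b c)) = g.clm (tmul a (tmul b c))) : f = g := by
  refine tensor_ext fun a x => ?_
  exact DFunLike.congr_fun (clm_ext (f := f.clm.comp (tmulL A (tensor B C) a))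
    (g := g.clm.comp (tmulL A (tensor B C) a)) (fun b c => h a b c)) x

theorem tensor_ext_four {A B C D X : Hilb.{u}} {f g : tensor (tensor (tensor A B) C) D ⟶ X}
    (h : ∀ a b c d, f.clm (tmul (tmul (tmul a b) c) d) = g.clm (tmul (tmul (tmul a b) c) d)) :
    f = g := by
  refine tensor_ext fun x d => ?_
  have := tensor_ext_left (f := ⟨f.clm.comp ((tmulL (tensor (tensor A B) C) D).flip d)⟩)
    (g := ⟨g.clm.comp ((tmulL (tensor (tensor A B) C) D).flip d)⟩) (fun a b c => h a b c d)
  exact congrArg (fun k : tensor (tensor A B) C ⟶ X => k.clm x) this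

/-- The tensor product of bounded operators. -/
noncomputable def map {A B C D : Hilb.{u}} (f : A ⟶ B) (g : C ⟶ D) : tensor A C ⟶ tensor B D :=
  ⟨(TensorProduct.mapL f.clm g.clm).completion⟩

@[simp]
theorem map_tmul {A B C D : Hilb.{u}} (f : A ⟶ B) (g : C ⟶ D) (a : A) (c : C) :
    (map f g).clm (tmul a c) = tmul (f.clm a) (g.clm c) :=
  ContinuousLinearMap.completion_apply_coe _ _

@[simp]
theorem assoc_hom_tmul {A B C : Hilb.{u}} (a : A) (b : B) (c : C) :
    (assoc A B C).hom.clm (tmul (tmul a b) c) = tmul a (tmul b c) :=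
  LinearEquiv.extendOfIsometry_eq (TensorProduct.assoc ℂ A B C) (inclL A B C).toLinearMap
    (inclR A B C).toLinearMap (denseRange_inclL A B C) (denseRange_inclR A B C)
    (norm_inclR_assoc A B C) ((a ⊗ₜ b) ⊗ₜ c)

@[simp]
theorem assoc_inv_tmul {A B C : Hilb.{u}} (a : A) (b : B) (c : C) :
    (assoc A B C).inv.clm (tmul a (tmul b c)) = tmul (tmul a b) c :=
  LinearEquiv.extendOfIsometry_symm_eq (TensorProduct.assoc ℂ A B C) (inclL A B C).toLinearMap
    (inclR A B C).toLinearMap (denseRange_inclL A B C) (denseRange_inclR A B C)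
    (norm_inclR_assoc A B C) (a ⊗ₜ (b ⊗ₜ c))

@[simp]
theorem flip_hom_tmul {A B : Hilb.{u}} (a : A) (b : B) :
    (flip A B).hom.clm (tmul a b) = tmul b a :=
  LinearEquiv.extendOfIsometry_eq (TensorProduct.comm ℂ A B) (incl A B).toLinearMap
    (incl B A).toLinearMap (denseRange_incl A B) (denseRange_incl B A) (norm_incl_comm A B)
    (a ⊗ₜ b)

noncomputable instance : InnerProductSpace ℂ (ULift.{u} ℂ) where
  inner x y := inner ℂ x.down y.down
  norm_sq_eq_re_inner x := norm_sq_eq_re_inner (𝕜 := ℂ) x.down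
  conj_inner_symm x y := inner_conj_symm x.down y.down
  add_left x y z := inner_add_left x.down y.down z.down
  smul_left x y c := inner_smul_left x.down y.down c

/-- The tensor unit `ℂ`. -/
noncomputable def unit : Hilb.{u} := ⟨ULift.{u} ℂ⟩

/-- The canonical isometry `ℂ ⊗ A ≅ A` on the algebraic tensor product. -/
noncomputable def lunitAlg (A : Hilb.{u}) : ULift.{u} ℂ ⊗[ℂ] A ≃ₗᵢ[ℂ] A :=
  (TensorProduct.congrIsometry (LinearIsometryEquiv.ulift ℂ ℂ)
    (LinearIsometryEquiv.refl ℂ A)).trans (TensorProduct.lidIsometry ℂ A)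

theorem norm_lunitAlg (A : Hilb.{u}) (x : ULift.{u} ℂ ⊗[ℂ] A) :
    ‖(LinearMap.id : A →ₗ[ℂ] A) ((lunitAlg A).toLinearEquiv x)‖ =
      ‖(Completion.toComplₗᵢ (𝕜 := ℂ) (E := ULift.{u} ℂ ⊗[ℂ] A)).toLinearMap x‖ :=
  ((lunitAlg A).norm_map x).trans (Completion.norm_coe x).symm

/-- The left unit transformation. -/
noncomputable def lunit (A : Hilb.{u}) : tensor unit A ≅ A :=
  isoOfIsometry (A := tensor unit A) (LinearEquiv.extendOfIsometry (lunitAlg A).toLinearEquiv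
    (Completion.toComplₗᵢ (𝕜 := ℂ) (E := ULift.{u} ℂ ⊗[ℂ] A)).toLinearMap LinearMap.id
    Completion.denseRange_coe Function.surjective_id.denseRange (norm_lunitAlg A))

@[simp]
theorem lunit_hom_tmul {A : Hilb.{u}} (c : unit.{u}) (a : A) :
    (lunit A).hom.clm (tmul c a) = (ULift.down c : ℂ) • a :=
  LinearEquiv.extendOfIsometry_eq (lunitAlg A).toLinearEquiv
    (Completion.toComplₗᵢ (𝕜 := ℂ) (E := ULift.{u} ℂ ⊗[ℂ] A)).toLinearMap LinearMap.id
    Completion.denseRange_coe Function.surjective_id.denseRange (norm_lunitAlg A) (c ⊗ₜ a)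

/-- The right unit transformation. -/
noncomputable def runit (A : Hilb.{u}) : tensor A unit ≅ A :=
  flip A unit ≪≫ lunit A

@[simp]
theorem runit_hom_tmul {A : Hilb.{u}} (c : unit.{u}) (a : A) :
    (runit A).hom.clm (tmul a c) = (ULift.down c : ℂ) • a := by
  simp [runit]

noncomputable instance : MonoidalCategoryStruct Hilb.{u} where
  tensorObj := tensor
  whiskerLeft A _ _ f := map (𝟙 A) f
  whiskerRight f B := map f (𝟙 B)
  tensorHom f g := map f g
  tensorUnit := unit
  associator := assoc
  leftUnitor := lunit
  rightUnitor := runit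

theorem smul_tmul {A B : Hilb.{u}} (c : ℂ) (a : A) (b : B) :
    tmul (c • a) b = tmul a (c • b) :=
  congrArg (fun t : A ⊗[ℂ] B => (t : Completion (A ⊗[ℂ] B))) (TensorProduct.smul_tmul c a b)

noncomputable instance : MonoidalCategory Hilb.{u} :=
  MonoidalCategory.ofTensorHom
    (id_tensorHom_id := fun A B => tensor_ext fun a b => map_tmul (𝟙 A) (𝟙 B) a b)
    (id_tensorHom := fun _ _ _ _ => rfl)
    (tensorHom_id := fun _ _ => rfl)
    (tensorHom_comp_tensorHom := fun f₁ f₂ g₁ g₂ => tensor_ext fun a b => by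
      change (map g₁ g₂).clm ((map f₁ f₂).clm (tmul a b)) = (map (f₁ ≫ g₁) (f₂ ≫ g₂)).clm (tmul a b)
      simp)
    (associator_naturality := fun {X₁ X₂ X₃ Y₁ Y₂ Y₃} f₁ f₂ f₃ => tensor_ext_left fun a b c => by
      change (assoc Y₁ Y₂ Y₃).hom.clm ((map (map f₁ f₂) f₃).clm (tmul (tmul a b) c)) =
        (map f₁ (map f₂ f₃)).clm ((assoc X₁ X₂ X₃).hom.clm (tmul (tmul a b) c))
      simp)
    (leftUnitor_naturality := fun {X Y} f => tensor_ext fun c a => by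
      change (lunit Y).hom.clm ((map (𝟙 unit) f).clm (tmul c a)) =
        f.clm ((lunit X).hom.clm (tmul c a))
      simp)
    (rightUnitor_naturality := fun {X Y} f => tensor_ext fun a c => by
      change (runit Y).hom.clm ((map f (𝟙 unit)).clm (tmul a c)) =
        f.clm ((runit X).hom.clm (tmul a c))
      simp)
    (pentagon := fun W X Y Z => tensor_ext_four fun a b c d => by
      change (map (𝟙 W) (assoc X Y Z).hom).clm ((assoc W (tensor X Y) Z).hom.clm
        ((map (assoc W X Y).hom (𝟙 Z)).clm (tmul (tmul (tmul a b) c) d))) =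
        (assoc W X (tensor Y Z)).hom.clm ((assoc (tensor W X) Y Z).hom.clm
          (tmul (tmul (tmul a b) c) d))
      simp)
    (triangle := fun X Y => tensor_ext_left fun a c b => by
      change (map (𝟙 X) (lunit Y).hom).clm ((assoc X unit Y).hom.clm (tmul (tmul a c) b)) =
        (map (runit X).hom (𝟙 Y)).clm (tmul (tmul a c) b)
      simp [smul_tmul])

noncomputable instance : SymmetricCategory Hilb.{u} where
  braiding := flip
  braiding_naturality_right X {Y Z} f := tensor_ext fun a b => by
    change (flip X Z).hom.clm ((map (𝟙 X) f).clm (tmul a b)) =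
      (map f (𝟙 X)).clm ((flip X Y).hom.clm (tmul a b))
    simp
  braiding_naturality_left {X Y} f Z := tensor_ext fun a b => by
    change (flip Y Z).hom.clm ((map f (𝟙 Z)).clm (tmul a b)) =
      (map (𝟙 Z) f).clm ((flip X Z).hom.clm (tmul a b))
    simp
  hexagon_forward X Y Z := tensor_ext_left fun a b c => by
    change (assoc Y Z X).hom.clm ((flip X (tensor Y Z)).hom.clm
        ((assoc X Y Z).hom.clm (tmul (tmul a b) c))) =
      (map (𝟙 Y) (flip X Z).hom).clm ((assoc Y X Z).hom.clm
        ((map (flip X Y).hom (𝟙 Z)).clm (tmul (tmul a b) c)))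
    simp
  hexagon_reverse X Y Z := tensor_ext_right fun a b c => by
    change (assoc Z X Y).inv.clm ((flip (tensor X Y) Z).hom.clm
        ((assoc X Y Z).inv.clm (tmul a (tmul b c)))) =
      (map (flip X Z).hom (𝟙 Y)).clm ((assoc X Z Y).inv.clm
        ((map (𝟙 X) (flip Y Z).hom).clm (tmul a (tmul b c))))
    simp
  symmetry X Y := tensor_ext fun a b => by
    change (flip Y X).hom.clm ((flip X Y).hom.clm (tmul a b)) = tmul a b
    simp

end Hilb

/-- Composition in operator order: `g ∘ₒ f` is `f` followed by `g`. -/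
notation:80 g:81 " ∘ₒ " f:80 => CategoryStruct.comp f g

namespace Hilb

section Legs

variable {A B C A' B' C' : Hilb.{u}}

/-- Leg numbering: `f₁₂ = f ⊗ 1`. -/
noncomputable def leg12 (C : Hilb.{u}) (f : A ⊗ B ⟶ A' ⊗ B') :
    (A ⊗ B) ⊗ C ⟶ (A' ⊗ B') ⊗ C :=
  f ▷ C

/-- Leg numbering: `f₂₃ = 1 ⊗ f`. -/
noncomputable def leg23 (A : Hilb.{u}) (f : B ⊗ C ⟶ B' ⊗ C') :
    (A ⊗ B) ⊗ C ⟶ (A ⊗ B') ⊗ C' :=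
  (α_ A B' C').inv ∘ₒ (A ◁ f) ∘ₒ (α_ A B C).hom

/-- Leg numbering: `f₁₃ = Σ₂₃ f₁₂ Σ₂₃`, acting trivially on the second leg `B`. -/
noncomputable def leg13 (B : Hilb.{u}) (f : A ⊗ C ⟶ A' ⊗ C') :
    (A ⊗ B) ⊗ C ⟶ (A' ⊗ B) ⊗ C' :=
  leg23 A' (β_ C' B).hom ∘ₒ leg12 B f ∘ₒ leg23 A (β_ B C).hom

end Legs

variable {H L K : Hilb.{u}}

/-- Multiplicative unitaries: unitaries that satisfy the pentagon equation
`W₂₃ W₁₂ = W₁₂ W₁₃ W₂₃`. -/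
structure IsMultiplicative (W : H ⊗ H ⟶ H ⊗ H) : Prop where
  unitary : IsUnitary W
  pentagon : leg23 H W ∘ₒ leg12 H W = leg12 H W ∘ₒ leg13 H W ∘ₒ leg23 H W

/-- Right representations of `W` on `K`: unitaries `S` on `K ⊗ H` with
`W₂₃ S₁₂ = S₁₂ S₁₃ W₂₃` on `K ⊗ H ⊗ H`. -/
structure IsRightRep (W : H ⊗ H ⟶ H ⊗ H) (S : K ⊗ H ⟶ K ⊗ H) : Prop where
  unitary : IsUnitary S
  rep : leg23 K W ∘ₒ leg12 H S = leg12 H S ∘ₒ leg13 H S ∘ₒ leg23 K W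

/-- Left representations of `W` on `K`: unitaries `V` on `H ⊗ K` with
`V₂₃ W₁₂ = W₁₂ V₁₃ V₂₃` on `H ⊗ H ⊗ K`. -/
structure IsLeftRep (W : H ⊗ H ⟶ H ⊗ H) (V : H ⊗ K ⟶ H ⊗ K) : Prop where
  unitary : IsUnitary V
  rep : leg23 H V ∘ₒ leg12 K W = leg12 K W ∘ₒ leg13 H V ∘ₒ leg23 H V

/-- `Z` is the unitary on `K ⊗ L` with `Z₁₃ = V₂₃ S₁₂* V₂₃* S₁₂` on `K ⊗ H ⊗ L`. -/
structure IsBraidingUnitary (V : H ⊗ L ⟶ H ⊗ L) (S : K ⊗ H ⟶ K ⊗ H) (Z : K ⊗ L ⟶ K ⊗ L) :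
    Prop where
  unitary : IsUnitary Z
  eq : leg13 H Z = leg23 K V ∘ₒ leg12 L (dag S) ∘ₒ leg23 K (dag V) ∘ₒ leg12 L S

/-- The unitary `Z` that defines the braiding exists. -/
def HasBraiding (V : H ⊗ L ⟶ H ⊗ L) (S : K ⊗ H ⟶ K ⊗ H) : Prop :=
  ∃ Z : K ⊗ L ⟶ K ⊗ L, IsBraidingUnitary V S Z

open Classical in
/-- The unitary `Z` that defines the braiding; it is unique if `H ≠ 0`. It is only used where it
exists; the default value is the identity. -/
noncomputable def braidZ (V : H ⊗ L ⟶ H ⊗ L) (S : K ⊗ H ⟶ K ⊗ H) : K ⊗ L ⟶ K ⊗ L :=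
  if h : HasBraiding V S then h.choose else 𝟙 (K ⊗ L)

/-- The braiding operator `L ⊗ K ⟶ K ⊗ L`, that is, `Z Σ`. -/
noncomputable def braid (V : H ⊗ L ⟶ H ⊗ L) (S : K ⊗ H ⟶ K ⊗ H) : L ⊗ K ⟶ K ⊗ L :=
  braidZ V S ∘ₒ (β_ L K).hom

/-- The dual braiding operator `K ⊗ L ⟶ L ⊗ K`, the inverse of the unitary `braid V S`. -/
noncomputable def dualBraid (V : H ⊗ L ⟶ H ⊗ L) (S : K ⊗ H ⟶ K ⊗ H) : K ⊗ L ⟶ L ⊗ K :=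
  dag (braid V S)

/-- The tensor product `S¹₁₃ S²₂₃` of right representations. -/
noncomputable def tensorS {K₁ K₂ : Hilb.{u}} (S₁ : K₁ ⊗ H ⟶ K₁ ⊗ H) (S₂ : K₂ ⊗ H ⟶ K₂ ⊗ H) :
    (K₁ ⊗ K₂) ⊗ H ⟶ (K₁ ⊗ K₂) ⊗ H :=
  leg13 K₂ S₁ ∘ₒ leg23 K₁ S₂

/-- The braided tensor product of `T₁` and `T₂`; the braiding is that of `L` with `(K₂, S₂)`. -/
noncomputable def tensorT {K₁ K₂ : Hilb.{u}} (V : H ⊗ L ⟶ H ⊗ L) (T₁ : K₁ ⊗ L ⟶ K₁ ⊗ L)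
    (S₂ : K₂ ⊗ H ⟶ K₂ ⊗ H) (T₂ : K₂ ⊗ L ⟶ K₂ ⊗ L) :
    (K₁ ⊗ K₂) ⊗ L ⟶ (K₁ ⊗ K₂) ⊗ L :=
  leg23 K₁ (braid V S₂) ∘ₒ leg12 K₂ T₁ ∘ₒ leg23 K₁ (dualBraid V S₂) ∘ₒ leg23 K₁ T₂

end Hilb

open Hilb

/-- Braided multiplicative unitaries `(W, U, V, F)` on the Hilbert spaces `H` and `L`. -/
structure BraidedMultUnitary (H L : Hilb.{u}) where
  W : H ⊗ H ⟶ H ⊗ H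
  U : L ⊗ H ⟶ L ⊗ H
  V : H ⊗ L ⟶ H ⊗ L
  F : L ⊗ L ⟶ L ⊗ L
  W_mult : IsMultiplicative W
  U_rep : IsRightRep W U
  V_rep : IsLeftRep W V
  /-- `U` and `V` are Drinfeld compatible: `U₂₃ W₁₃ V₁₂ = V₁₂ W₁₃ U₂₃` on `H ⊗ L ⊗ H`. -/
  drinfeld : leg23 H U ∘ₒ leg13 L W ∘ₒ leg12 H V = leg12 H V ∘ₒ leg13 L W ∘ₒ leg23 H U
  F_unitary : IsUnitary F
  /-- `F` is equivariant for `U`: `U₁₃ U₂₃ F₁₂ = F₁₂ U₁₃ U₂₃` on `L ⊗ L ⊗ H`. -/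
  F_U : leg13 L U ∘ₒ leg23 L U ∘ₒ leg12 H F = leg12 H F ∘ₒ leg13 L U ∘ₒ leg23 L U
  /-- `F` is equivariant for `V`: `V₁₃ V₁₂ F₂₃ = F₂₃ V₁₃ V₁₂` on `H ⊗ L ⊗ L`. -/
  F_V : leg13 L V ∘ₒ leg12 L V ∘ₒ leg23 H F = leg23 H F ∘ₒ leg13 L V ∘ₒ leg12 L V
  /-- The braiding operator on `L ⊗ L` exists. -/
  U_braid : HasBraiding V U
  /-- The top-braided pentagon equation on `L ⊗ L ⊗ L`. -/
  pentagon : leg23 L F ∘ₒ leg12 L F =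
    leg12 L F ∘ₒ leg23 L (braid V U) ∘ₒ leg12 L F ∘ₒ leg23 L (dualBraid V U) ∘ₒ leg23 L F

namespace BraidedMultUnitary

variable {H L : Hilb.{u}} (B : BraidedMultUnitary H L)

/-- Right representations `(K, S, T)` of a braided multiplicative unitary. That the braiding
operator of `L` with `(K, S)` exists is part of the definition. -/
structure IsRep {K : Hilb.{u}} (S : K ⊗ H ⟶ K ⊗ H) (T : K ⊗ L ⟶ K ⊗ L) : Prop where
  S_rep : IsRightRep B.W S
  S_braid : HasBraiding B.V S
  T_unitary : IsUnitary T
  /-- `S₁₃ U₂₃ T₁₂ = T₁₂ S₁₃ U₂₃` on `K ⊗ L ⊗ H`. -/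
  T_equivariant : leg13 L S ∘ₒ leg23 K B.U ∘ₒ leg12 H T = leg12 H T ∘ₒ leg13 L S ∘ₒ leg23 K B.U
  /-- The top-braided representation condition on `K ⊗ L ⊗ L`. -/
  T_rep : leg23 K B.F ∘ₒ leg12 L T = leg12 L T ∘ₒ leg23 K (braid B.V B.U) ∘ₒ leg12 L T ∘ₒ
    leg23 K (dualBraid B.V B.U) ∘ₒ leg23 K B.F

/-- The objects of the category of right representations. -/
structure Rep : Type (u + 1) where
  K : Hilb.{u}
  S : K ⊗ H ⟶ K ⊗ H
  T : K ⊗ L ⟶ K ⊗ L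
  isRep : B.IsRep S T

variable {B}

/-- The arrows are the bounded operators that intertwine both representations. -/
@[ext]
structure Rep.Hom (x y : B.Rep) where
  map : x.K ⟶ y.K
  S_comm : (map ▷ H) ∘ₒ x.S = y.S ∘ₒ (map ▷ H)
  T_comm : (map ▷ L) ∘ₒ x.T = y.T ∘ₒ (map ▷ L)

instance : Category B.Rep where
  Hom x y := Rep.Hom x y
  id x := ⟨𝟙 x.K, by simp, by simp⟩
  comp f g := ⟨f.map ≫ g.map,
    by rw [comp_whiskerRight, ← Category.assoc, f.S_comm, Category.assoc, g.S_comm,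
      Category.assoc],
    by rw [comp_whiskerRight, ← Category.assoc, f.T_comm, Category.assoc, g.T_comm,
      Category.assoc]⟩

variable (B)

/-- The forgetful functor to Hilbert spaces. -/
def forget : B.Rep ⥤ Hilb.{u} where
  obj x := x.K
  map f := f.map

end BraidedMultUnitary

namespace Hilb

theorem dag_id (A : Hilb.{u}) : dag (𝟙 A) = 𝟙 A :=
  Hom.ext ContinuousLinearMap.adjoint_id

theorem dag_comp {A B C : Hilb.{u}} (f : A ⟶ B) (g : B ⟶ C) : dag (f ≫ g) = dag g ≫ dag f :=
  Hom.ext (ContinuousLinearMap.adjoint_comp g.clm f.clm)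

theorem isUnitary_id (A : Hilb.{u}) : IsUnitary (𝟙 A) := by
  constructor <;> simp [dag_id]

theorem IsUnitary.comp {A B C : Hilb.{u}} {f : A ⟶ B} {g : B ⟶ C} (hf : IsUnitary f)
    (hg : IsUnitary g) : IsUnitary (f ≫ g) where
  comp_dag := by
    rw [Hilb.dag_comp, Category.assoc, ← Category.assoc g, hg.comp_dag, Category.id_comp, hf.comp_dag]
  dag_comp := by
    rw [Hilb.dag_comp, Category.assoc, ← Category.assoc _ f, hf.dag_comp, Category.id_comp,
      hg.dag_comp]

theorem isUnitary_isoOfIsometry {A B : Hilb.{u}} (e : A ≃ₗᵢ[ℂ] B) :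
    IsUnitary (isoOfIsometry e).hom := by
  have h : dag (isoOfIsometry e).hom = (isoOfIsometry e).inv :=
    Hom.ext (LinearIsometryEquiv.adjoint_eq_symm e)
  constructor <;> simp [h]

theorem isUnitary_braiding (A B : Hilb.{u}) : IsUnitary (β_ A B).hom :=
  isUnitary_isoOfIsometry _

variable {A B C H K L : Hilb.{u}}

theorem leg12_id : leg12 C (𝟙 (A ⊗ B)) = 𝟙 ((A ⊗ B) ⊗ C) := by simp [leg12]

theorem leg23_id : leg23 A (𝟙 (B ⊗ C)) = 𝟙 ((A ⊗ B) ⊗ C) := by simp [leg23]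

theorem leg23_comp {B' C' B'' C'' : Hilb.{u}} (f : B ⊗ C ⟶ B' ⊗ C') (g : B' ⊗ C' ⟶ B'' ⊗ C'') :
    leg23 A f ≫ leg23 A g = leg23 A (f ≫ g) := by simp [leg23]

theorem leg13_id : leg13 B (𝟙 (A ⊗ C)) = 𝟙 ((A ⊗ B) ⊗ C) := by
  rw [leg13, leg12_id, Category.comp_id, leg23_comp, SymmetricCategory.symmetry, leg23_id]

theorem braidZ_spec {V : H ⊗ L ⟶ H ⊗ L} {S : K ⊗ H ⟶ K ⊗ H} (h : HasBraiding V S) :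
    IsBraidingUnitary V S (braidZ V S) := by
  rw [braidZ, dif_pos h]
  exact h.choose_spec

theorem isUnitary_braid {V : H ⊗ L ⟶ H ⊗ L} {S : K ⊗ H ⟶ K ⊗ H} (h : HasBraiding V S) :
    IsUnitary (braid V S) :=
  (isUnitary_braiding L K).comp (braidZ_spec h).unitary

end Hilb

namespace BraidedMultUnitary

variable {H L : Hilb.{u}} (B : BraidedMultUnitary H L)

theorem isRep_trivial (K : Hilb.{u}) : B.IsRep (𝟙 (K ⊗ H)) (𝟙 (K ⊗ L)) where
  S_rep := ⟨isUnitary_id _, by simp [leg12_id, leg13_id]⟩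
  S_braid := ⟨𝟙 _, isUnitary_id _, by
    simp [leg12_id, leg13_id, dag_id, leg23_comp, B.V_rep.unitary.dag_comp, leg23_id]⟩
  T_unitary := isUnitary_id _
  T_equivariant := by simp [leg12_id, leg13_id]
  T_rep := by
    simp [leg12_id, leg23_comp, dualBraid, (isUnitary_braid B.U_braid).dag_comp]

/-- The functor `τ`, which equips a Hilbert space `K` with the trivial representation
`(K, 1, 1)`. -/
noncomputable def trivial : Hilb.{u} ⥤ B.Rep where
  obj K := ⟨K, 𝟙 _, 𝟙 _, B.isRep_trivial K⟩
  map f := ⟨f, by simp, by simp⟩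

end BraidedMultUnitary

/-- Strict monoidal functors. Heterogeneous equality identifies arrows along the equalities of
objects `F (x ⊗ y) = F x ⊗ F y` and `F 1 = 1`. -/
structure IsStrictMonoidal {C D : Type*} [Category C] [MonoidalCategory C] [Category D]
    [MonoidalCategory D] (F : C ⥤ D) : Prop where
  obj_tensor : ∀ x y : C, F.obj (x ⊗ y) = F.obj x ⊗ F.obj y
  obj_unit : F.obj (𝟙_ C) = 𝟙_ D
  map_tensor : ∀ {x x' y y' : C} (f : x ⟶ x') (g : y ⟶ y'),
    HEq (F.map (f ⊗ₘ g)) (F.map f ⊗ₘ F.map g)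
  map_associator : ∀ x y z : C,
    HEq (F.map (α_ x y z).hom) (α_ (F.obj x) (F.obj y) (F.obj z)).hom
  map_leftUnitor : ∀ x : C, HEq (F.map (λ_ x).hom) (λ_ (F.obj x)).hom
  map_rightUnitor : ∀ x : C, HEq (F.map (ρ_ x).hom) (ρ_ (F.obj x)).hom

/-- A faithful functor to Hilbert spaces makes its domain a (concrete) W*-category: its arrow
spaces are identified with weakly closed linear subspaces of the spaces of bounded operators, and
adjoints of arrows are arrows. -/
structure IsConcreteWStar {C : Type*} [Category C] (For : C ⥤ Hilb.{u}) : Prop where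
  faithful : For.Faithful
  linear : ∀ x y : C, ∃ M : Submodule ℂ (For.obj x →L[ℂ] For.obj y),
    (M : Set (For.obj x →L[ℂ] For.obj y)) = Set.range fun f : x ⟶ y => (For.map f).clm
  adjoint : ∀ {x y : C} (f : x ⟶ y), ∃ g : y ⟶ x, For.map g = dag (For.map f)
  weakly_closed : ∀ x y : C,
    IsClosed {a : For.obj x →WOT[ℂ] For.obj y | ∃ f : x ⟶ y, (For.map f).clm = a.toCLM}

/-- Hilbert space tensor categories: monoidal W*-categories `C` with a faithful strict monoidal
functor `For` to Hilbert spaces and a strict monoidal functor `τ` from Hilbert spaces with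
`For ∘ τ = id`, such that (1) objects with the same underlying Hilbert space are equal once the
identity operator is an arrow between them, and (2) an operator `a` comes from an arrow once
`a ⊗ 1` or `1 ⊗ a` does so, where the other factor is nonzero. -/
structure IsHilbertSpaceTensorCategory {C : Type*} [Category C] [MonoidalCategory C]
    (For : C ⥤ Hilb.{u}) (τ : Hilb.{u} ⥤ C) : Prop where
  wstar : IsConcreteWStar For
  for_strict : IsStrictMonoidal For
  tau_strict : IsStrictMonoidal τ
  tau_for : τ ⋙ For = 𝟭 Hilb.{u}
  eq_of_id : ∀ (x x' : C) (h : For.obj x = For.obj x') (f : x ⟶ x'),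
    For.map f = eqToHom h → x = x'
  cancel_right : ∀ (x₁ x₂ y : C) (a : For.obj x₁ ⟶ For.obj x₂), Nontrivial (For.obj y) →
    (∃ f : x₁ ⊗ y ⟶ x₂ ⊗ y, HEq (For.map f) (a ▷ For.obj y)) →
    ∃ g : x₁ ⟶ x₂, For.map g = a
  cancel_left : ∀ (x₁ x₂ y : C) (a : For.obj x₁ ⟶ For.obj x₂), Nontrivial (For.obj y) →
    (∃ f : y ⊗ x₁ ⟶ y ⊗ x₂, HEq (For.map f) (For.obj y ◁ a)) →
    ∃ g : x₁ ⟶ x₂, For.map g = a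

/-! Everything reduces to computing with unitaries on three or four legs, using two tools. A
leg-numbered operator is characterised by what it does once a vector is fixed in an idle leg
(`insl_leg23`, `insr_leg13`), so identities between such operators are checked one vector at a time.
Conversely, a nonzero idle leg may be dropped (`leg13_injective`, `leg134_injective`). The latter is
indispensable because the braiding unitary `Z` is known only through `Z₁₃ = V₂₃ S₁₂* V₂₃* S₁₂`; with
`H ≠ 0` it makes `Z` unique and allows proofs about `Z` on an enlarged space.

This formula makes `Z` behave like a braiding. It is multiplicative in `S` (`braiding_tensor`),
natural for intertwiners of `S` (`braidZ_natural`) and for `F` on the other side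
(`braiding_natural_left`). Drinfeld compatibility of `U` and `V` makes `Z` itself equivariant
(`braiding_equivariant`). Naturality applied to `Z` is then the Yang–Baxter equation
(`yang_baxter`), and applied to `T` it is `braiding_natural_right`. Together with commutation of
operators on disjoint legs, these are exactly the relations used by the group identity
`braided_corepresentation_tensor`, which shows that the tensor product is again a representation
(`isRep_tensor`).

The same facts give the monoidal structure. Naturality makes tensor products of arrows into arrows,
and multiplicativity makes the associators of Hilbert spaces into arrows; the coherence laws are
inherited because arrows are determined by their underlying operators. The intertwiner conditions
are linear and weakly closed since they can be tested on slices (`intertwines_iff_slice`). A tensor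
factor is cancelled by removing its unitaries and then dropping the idle leg. -/

namespace Hilb

/-! ### Inserting vectors and testing operators on them -/

section Insertion

variable {A B C D A' B' C' D' X : Hilb.{u}}

/-- Insertion of a vector on the left, `b ↦ a ⊗ b`. -/
noncomputable def insl (B : Hilb.{u}) (a : A) : B ⟶ A ⊗ B := ⟨tmulL A B a⟩

/-- Insertion of a vector on the right, `a ↦ a ⊗ b`. -/
noncomputable def insr (A : Hilb.{u}) (b : B) : A ⟶ A ⊗ B := ⟨(tmulL A B).flip b⟩

theorem insl_apply (a : A) (b : B) : (insl B a).clm b = tmul a b := rfl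

theorem insr_apply (a : A) (b : B) : (insr A b).clm a = tmul a b := rfl

theorem whiskerRight_tmul (f : A ⟶ A') (a : A) (b : B) :
    (f ▷ B).clm (tmul a b) = tmul (f.clm a) b := map_tmul f (𝟙 B) a b

theorem whiskerLeft_tmul (f : B ⟶ B') (a : A) (b : B) :
    (A ◁ f).clm (tmul a b) = tmul a (f.clm b) := map_tmul (𝟙 A) f a b

theorem associator_hom_tmul (a : A) (b : B) (c : C) :
    (α_ A B C).hom.clm (tmul (tmul a b) c) = tmul a (tmul b c) := assoc_hom_tmul a b c

theorem associator_inv_tmul (a : A) (b : B) (c : C) :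
    (α_ A B C).inv.clm (tmul a (tmul b c)) = tmul (tmul a b) c := assoc_inv_tmul a b c

theorem braiding_hom_tmul (a : A) (b : B) : (β_ A B).hom.clm (tmul a b) = tmul b a :=
  flip_hom_tmul a b

theorem ext_tmul {f g : A ⊗ B ⟶ X} (h : ∀ a b, f.clm (tmul a b) = g.clm (tmul a b)) : f = g :=
  tensor_ext h

theorem ext_insr {f g : A ⊗ B ⟶ X} (h : ∀ b : B, insr A b ≫ f = insr A b ≫ g) : f = g :=
  tensor_ext fun a b => congrArg (fun k : A ⟶ X => k.clm a) (h b)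

/-- Elementary tensors span a dense subspace, so the vector in one leg may be held fixed. This is
the induction principle behind the identities between leg-numbered operators. -/
theorem ext_insr_whiskerRight {f g : (A ⊗ B) ⊗ C ⟶ X}
    (h : ∀ b : B, insr A b ▷ C ≫ f = insr A b ▷ C ≫ g) : f = g :=
  tensor_ext_left fun a b c => by
    have := congrArg (fun k : A ⊗ C ⟶ X => k.clm (tmul a c)) (h b)
    simpa only [comp_clm, ContinuousLinearMap.comp_apply, whiskerRight_tmul, insr_apply] using this

theorem ext_insl_whiskerRight {f g : (A ⊗ B) ⊗ C ⟶ X}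
    (h : ∀ a : A, insl B a ▷ C ≫ f = insl B a ▷ C ≫ g) : f = g :=
  tensor_ext_left fun a b c => by
    have := congrArg (fun k : B ⊗ C ⟶ X => k.clm (tmul b c)) (h a)
    simpa only [comp_clm, ContinuousLinearMap.comp_apply, whiskerRight_tmul, insl_apply] using this

theorem ext_insr_whiskerRight₂ {f g : ((A ⊗ B) ⊗ C) ⊗ D ⟶ X}
    (h : ∀ b : B, insr A b ▷ C ▷ D ≫ f = insr A b ▷ C ▷ D ≫ g) : f = g :=
  tensor_ext_four fun a b c d => by
    have := congrArg (fun k : (A ⊗ C) ⊗ D ⟶ X => k.clm (tmul (tmul a c) d)) (h b)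
    simpa only [comp_clm, ContinuousLinearMap.comp_apply, whiskerRight_tmul, insr_apply] using this

theorem ext_insl_whiskerRight₂ {f g : ((A ⊗ B) ⊗ C) ⊗ D ⟶ X}
    (h : ∀ a : A, insl B a ▷ C ▷ D ≫ f = insl B a ▷ C ▷ D ≫ g) : f = g :=
  tensor_ext_four fun a b c d => by
    have := congrArg (fun k : (B ⊗ C) ⊗ D ⟶ X => k.clm (tmul (tmul b c) d)) (h a)
    simpa only [comp_clm, ContinuousLinearMap.comp_apply, whiskerRight_tmul, insl_apply] using this

theorem insr_whiskerRight (f : A ⟶ A') (c : C) : insr A c ≫ f ▷ C = f ≫ insr A' c := by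
  ext a
  simp only [comp_clm, ContinuousLinearMap.comp_apply, insr_apply, whiskerRight_tmul]

theorem insr_whiskerLeft (g : B ⟶ B') (b : B) : insr A b ≫ A ◁ g = insr A (g.clm b) := by
  ext a
  simp only [comp_clm, ContinuousLinearMap.comp_apply, insr_apply, whiskerLeft_tmul]

theorem insl_whiskerLeft (g : B ⟶ B') (a : A) : insl B a ≫ A ◁ g = g ≫ insl B' a := by
  ext b
  simp only [comp_clm, ContinuousLinearMap.comp_apply, insl_apply, whiskerLeft_tmul]

theorem insr_braiding (b : B) : insr A b ≫ (β_ A B).hom = insl A b := by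
  ext a
  simp only [comp_clm, ContinuousLinearMap.comp_apply, insr_apply, insl_apply, braiding_hom_tmul]

theorem insl_associator (a : A) : insl B a ▷ C ≫ (α_ A B C).hom = insl (B ⊗ C) a := by
  refine ext_tmul fun b c => ?_
  simp only [comp_clm, ContinuousLinearMap.comp_apply, insl_apply, whiskerRight_tmul,
    associator_hom_tmul]

theorem insr_leg12 (f : A ⊗ B ⟶ A' ⊗ B') (c : C) :
    insr (A ⊗ B) c ≫ leg12 C f = f ≫ insr (A' ⊗ B') c := insr_whiskerRight f c

theorem insl_leg23 (f : B ⊗ C ⟶ B' ⊗ C') (a : A) :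
    insl B a ▷ C ≫ leg23 A f = f ≫ insl B' a ▷ C' := by
  rw [leg23, Category.assoc, reassoc_of% (insl_associator (B := B) (C := C) a),
    reassoc_of% insl_whiskerLeft f a, ← insl_associator (B := B'), Category.assoc,
    Iso.hom_inv_id, Category.comp_id]

theorem insr_whiskerRight_leg23_braiding (b : B) :
    insr A b ▷ C ≫ leg23 A (β_ B C).hom = insr (A ⊗ C) b := by
  refine ext_tmul fun a c => ?_
  simp only [leg23, comp_clm, ContinuousLinearMap.comp_apply, insr_apply, whiskerRight_tmul,
    associator_hom_tmul, whiskerLeft_tmul, braiding_hom_tmul, associator_inv_tmul]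

theorem insr_leg23_braiding (b : B) :
    insr (A ⊗ C) b ≫ leg23 A (β_ C B).hom = insr A b ▷ C := by
  refine ext_tmul fun a c => ?_
  simp only [leg23, comp_clm, ContinuousLinearMap.comp_apply, insr_apply, whiskerRight_tmul,
    associator_hom_tmul, whiskerLeft_tmul, braiding_hom_tmul, associator_inv_tmul]

/-- The two flips in `leg13` carry the fixed vector out of the middle leg and back. Together with
`ext_insr_whiskerRight`, this characterises `leg13` without further mention of flips. -/
theorem insr_leg13 (f : A ⊗ C ⟶ A' ⊗ C') (b : B) :
    insr A b ▷ C ≫ leg13 B f = f ≫ insr A' b ▷ C' := by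
  rw [leg13, Category.assoc, reassoc_of% (insr_whiskerRight_leg23_braiding (A := A) (C := C) b),
    reassoc_of% insr_leg12 f b, insr_leg23_braiding]

end Insertion

/-! ### Functoriality and naturality of leg numbering -/

section Functoriality

variable {A B C D A' B' C' A'' B'' C'' : Hilb.{u}}

theorem leg12_comp (f : A ⊗ B ⟶ A' ⊗ B') (g : A' ⊗ B' ⟶ A'' ⊗ B'') :
    leg12 C f ≫ leg12 C g = leg12 C (f ≫ g) := (comp_whiskerRight f g C).symm

theorem leg13_comp (f : A ⊗ C ⟶ A' ⊗ C') (g : A' ⊗ C' ⟶ A'' ⊗ C'') :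
    leg13 B f ≫ leg13 B g = leg13 B (f ≫ g) := by
  refine ext_insr_whiskerRight fun b => ?_
  rw [reassoc_of% insr_leg13 f b, insr_leg13, insr_leg13, Category.assoc]

theorem leg12_whiskerRight (a : A ⟶ A') : leg12 C (a ▷ B) = a ▷ B ▷ C := rfl

theorem leg13_whiskerRight (a : A ⟶ A') : leg13 B (a ▷ C) = a ▷ B ▷ C := by
  refine ext_insr_whiskerRight fun b => ?_
  rw [insr_leg13, ← comp_whiskerRight, ← comp_whiskerRight, insr_whiskerRight]

theorem leg23_whiskerRight (b : B ⟶ B') : leg23 A (b ▷ C) = (A ◁ b) ▷ C := by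
  refine ext_insl_whiskerRight fun a => ?_
  rw [insl_leg23, ← comp_whiskerRight, ← comp_whiskerRight, insl_whiskerLeft]

theorem whiskerRight_leg23 (a : A ⟶ A') (f : B ⊗ C ⟶ B' ⊗ C') :
    a ▷ B ▷ C ≫ leg23 A' f = leg23 A f ≫ a ▷ B' ▷ C' := by
  simp only [leg23, Category.assoc, ← associator_inv_naturality_left, whisker_exchange_assoc,
    associator_naturality_left_assoc]

theorem whiskerLeft_leg13 (b : B ⟶ B') (f : A ⊗ C ⟶ A' ⊗ C') :
    (A ◁ b) ▷ C ≫ leg13 B' f = leg13 B f ≫ (A' ◁ b) ▷ C' := by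
  refine ext_insr_whiskerRight fun x => ?_
  rw [← comp_whiskerRight_assoc, insr_whiskerLeft, insr_leg13, reassoc_of% insr_leg13 f x,
    ← comp_whiskerRight, insr_whiskerLeft]

/-- Moving the idle leg to the front; this carries injectivity from `leg13` over to `leg23`. -/
theorem leg13_eq_leg23 (f : A ⊗ C ⟶ A' ⊗ C') :
    (β_ A B).hom ▷ C ≫ leg23 B f = leg13 B f ≫ (β_ A' B).hom ▷ C' := by
  refine ext_insr_whiskerRight fun x => ?_
  rw [← comp_whiskerRight_assoc, insr_braiding, insl_leg23, reassoc_of% insr_leg13 f x,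
    ← comp_whiskerRight, insr_braiding]

end Functoriality

/-! ### Operators on four legs and commutation on disjoint legs -/

section FourLegs

variable {A B C D : Hilb.{u}}

/-- The extension of an operator on the legs 1, 3, 4 to four legs. -/
noncomputable def leg134 (B : Hilb.{u}) (f : (A ⊗ C) ⊗ D ⟶ (A ⊗ C) ⊗ D) :
    ((A ⊗ B) ⊗ C) ⊗ D ⟶ ((A ⊗ B) ⊗ C) ⊗ D :=
  leg23 A (β_ C B).hom ▷ D ∘ₒ leg13 B f ∘ₒ leg23 A (β_ B C).hom ▷ D

/-- The extension of an operator on the legs 2, 3, 4 to four legs. -/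
noncomputable def leg234 (A : Hilb.{u}) (f : (B ⊗ C) ⊗ D ⟶ (B ⊗ C) ⊗ D) :
    ((A ⊗ B) ⊗ C) ⊗ D ⟶ ((A ⊗ B) ⊗ C) ⊗ D :=
  (α_ A B C).inv ▷ D ∘ₒ leg23 A f ∘ₒ (α_ A B C).hom ▷ D

theorem insr_leg134 (f : (A ⊗ C) ⊗ D ⟶ (A ⊗ C) ⊗ D) (b : B) :
    insr A b ▷ C ▷ D ≫ leg134 B f = f ≫ insr A b ▷ C ▷ D := by
  rw [leg134, Category.assoc, ← comp_whiskerRight_assoc, insr_whiskerRight_leg23_braiding,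
    reassoc_of% insr_leg13 f b, ← comp_whiskerRight, insr_leg23_braiding]

theorem insl_leg234 (f : (B ⊗ C) ⊗ D ⟶ (B ⊗ C) ⊗ D) (a : A) :
    insl B a ▷ C ▷ D ≫ leg234 A f = f ≫ insl B a ▷ C ▷ D := by
  rw [leg234, Category.assoc, ← comp_whiskerRight_assoc, insl_associator,
    reassoc_of% insl_leg23 f a, ← comp_whiskerRight, ← insl_associator, Category.assoc,
    Iso.hom_inv_id, Category.comp_id]

theorem leg124_leg12 (f : A ⊗ B ⟶ A ⊗ B) :
    leg13 C (leg12 D f) = leg12 D (leg12 C f) :=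
  leg13_whiskerRight f

theorem leg134_leg12 (f : A ⊗ C ⟶ A ⊗ C) : leg134 B (leg12 D f) = leg12 D (leg13 B f) := by
  refine ext_insr_whiskerRight₂ fun b => ?_
  rw [insr_leg134, leg12, leg12, ← comp_whiskerRight, ← comp_whiskerRight, insr_leg13]

theorem leg134_leg13 (f : A ⊗ D ⟶ A ⊗ D) : leg134 B (leg13 C f) = leg13 C (leg13 B f) := by
  refine ext_insr_whiskerRight₂ fun b => ?_
  rw [insr_leg134, ← leg13_whiskerRight, leg13_comp, leg13_comp, insr_leg13]

theorem leg134_leg23 (f : C ⊗ D ⟶ C ⊗ D) : leg134 B (leg23 A f) = leg23 (A ⊗ B) f := by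
  refine ext_insr_whiskerRight₂ fun b => ?_
  rw [insr_leg134, whiskerRight_leg23]

theorem leg234_leg12 (f : B ⊗ C ⟶ B ⊗ C) : leg234 A (leg12 D f) = leg12 D (leg23 A f) := by
  refine ext_insl_whiskerRight₂ fun a => ?_
  rw [insl_leg234, leg12, leg12, ← comp_whiskerRight, ← comp_whiskerRight, insl_leg23]

theorem leg234_leg13 (f : B ⊗ D ⟶ B ⊗ D) : leg234 A (leg13 C f) = leg13 C (leg23 A f) := by
  refine ext_insl_whiskerRight₂ fun a => ?_
  rw [insl_leg234, ← leg13_whiskerRight, leg13_comp, leg13_comp, insl_leg23]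

theorem leg234_leg23 (f : C ⊗ D ⟶ C ⊗ D) : leg234 A (leg23 B f) = leg23 (A ⊗ B) f := by
  refine ext_insl_whiskerRight₂ fun a => ?_
  rw [insl_leg234, whiskerRight_leg23]

theorem leg12_comp_leg34 (f : A ⊗ B ⟶ A ⊗ B) (g : C ⊗ D ⟶ C ⊗ D) :
    leg12 D (leg12 C f) ≫ leg23 (A ⊗ B) g = leg23 (A ⊗ B) g ≫ leg12 D (leg12 C f) :=
  whiskerRight_leg23 f g

/-- The first leg is idle on both sides; once a vector is fixed there, this is `leg13_eq_leg23`. -/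
theorem leg24_eq_conj (g : B ⊗ D ⟶ B ⊗ D) :
    leg23 A (β_ B C).hom ▷ D ≫ leg23 (A ⊗ C) g =
      leg13 C (leg23 A g) ≫ leg23 A (β_ B C).hom ▷ D := by
  refine ext_insl_whiskerRight₂ fun a => ?_
  rw [← comp_whiskerRight_assoc, insl_leg23, comp_whiskerRight_assoc, whiskerRight_leg23,
    ← leg234_leg13, reassoc_of% insl_leg234 (leg13 C g) a, ← comp_whiskerRight, insl_leg23,
    comp_whiskerRight, reassoc_of% leg13_eq_leg23 (B := C) g]

/-- Conjugating by the flip of legs 2 and 3 turns this into the evident case of legs 12 and 34. -/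
theorem leg13_comp_leg24 (f : A ⊗ C ⟶ A ⊗ C) (g : B ⊗ D ⟶ B ⊗ D) :
    leg12 D (leg13 B f) ≫ leg13 C (leg23 A g) = leg13 C (leg23 A g) ≫ leg12 D (leg13 B f) := by
  have hσ : leg23 A (β_ B C).hom ▷ D ≫ leg23 A (β_ C B).hom ▷ D = 𝟙 _ := by
    rw [← comp_whiskerRight, leg23_comp, SymmetricCategory.symmetry, leg23_id, id_whiskerRight]
  have h : leg23 A (β_ C B).hom ▷ D ≫ leg13 C (leg23 A g) =
      leg23 (A ⊗ C) g ≫ leg23 A (β_ C B).hom ▷ D := by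
    have hσ' : leg23 A (β_ C B).hom ▷ D ≫ leg23 A (β_ B C).hom ▷ D = 𝟙 _ := by
      rw [← comp_whiskerRight, leg23_comp, SymmetricCategory.symmetry, leg23_id, id_whiskerRight]
    rw [← Category.comp_id (leg13 C (leg23 A g)), ← hσ, ← reassoc_of% leg24_eq_conj g,
      reassoc_of% hσ']
  rw [leg13, leg12, comp_whiskerRight, comp_whiskerRight]
  simp only [Category.assoc]
  have h' : leg12 B f ▷ D ≫ leg23 (A ⊗ C) g = leg23 (A ⊗ C) g ≫ leg12 B f ▷ D :=
    leg12_comp_leg34 f g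
  rw [h, ← reassoc_of% leg24_eq_conj g, reassoc_of% h']

/-- Conjugating by the flip of legs 3 and 4 turns this into the case of legs 13 and 24. -/
theorem leg14_comp_leg23 (f : A ⊗ D ⟶ A ⊗ D) (g : B ⊗ C ⟶ B ⊗ C) :
    leg13 C (leg13 B f) ≫ leg12 D (leg23 A g) = leg12 D (leg23 A g) ≫ leg13 C (leg13 B f) := by
  have hσ : leg23 (A ⊗ B) (β_ C D).hom ≫ leg23 (A ⊗ B) (β_ D C).hom = 𝟙 _ := by
    rw [leg23_comp, SymmetricCategory.symmetry, leg23_id]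
  have hσ' : leg23 (A ⊗ B) (β_ D C).hom ≫ leg23 (A ⊗ B) (β_ C D).hom = 𝟙 _ := by
    rw [leg23_comp, SymmetricCategory.symmetry, leg23_id]
  have h : leg23 (A ⊗ B) (β_ D C).hom ≫ leg12 D (leg23 A g) =
      leg13 D (leg23 A g) ≫ leg23 (A ⊗ B) (β_ D C).hom := by
    rw [leg13]
    simp only [Category.assoc]
    rw [hσ, Category.comp_id]
  have h' : leg23 (A ⊗ B) (β_ C D).hom ≫ leg13 D (leg23 A g) =
      leg12 D (leg23 A g) ≫ leg23 (A ⊗ B) (β_ C D).hom := by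
    rw [leg13]
    simp only [Category.assoc]
    rw [reassoc_of% hσ]
  rw [show leg13 C (leg13 B f) = leg23 (A ⊗ B) (β_ D C).hom ∘ₒ leg12 C (leg13 B f) ∘ₒ
    leg23 (A ⊗ B) (β_ C D).hom from rfl]
  simp only [Category.assoc]
  rw [h, reassoc_of% leg13_comp_leg24 f g, reassoc_of% h']

end FourLegs

end Hilb

/-! ### The computations, as identities in an abstract group -/

section GroupIdentities

variable {G : Type*} [Group G]

/-- Multiplying by `w` on the right lets `s` be absorbed through `w * S = S * s * w`. The relation
`hV` then moves `u` and `w` past `V⁻¹`, the absorption is undone on the other side, and `w` cancels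
because it commutes with `Z`. -/
theorem commutator_intertwines {s u w S V Z : G} (hV : u * w * V = V * w * u)
    (hS : w * S = S * s * w) (hZ : Z = V * S⁻¹ * V⁻¹ * S) (hwZ : w * Z = Z * w)
    (hsV : s * V = V * s) (hSu : S * u = u * S) : s * u * Z = Z * u * s := by
  have hV' : w * u * V⁻¹ = V⁻¹ * u * w := by
    rw [mul_inv_eq_iff_eq_mul, mul_assoc, mul_assoc, eq_inv_mul_iff_mul_eq]
    simpa only [mul_assoc] using hV.symm
  have hS' : S⁻¹ * w = s * w * S⁻¹ := by
    rw [inv_mul_eq_iff_eq_mul, ← mul_assoc, eq_mul_inv_iff_mul_eq, ← mul_assoc, hS]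
  have hSu' : S⁻¹ * u = u * S⁻¹ := by
    rw [inv_mul_eq_iff_eq_mul, ← mul_assoc, eq_mul_inv_iff_mul_eq, hSu]
  have key : Z * u * s * w = s * u * Z * w := by
    calc Z * u * s * w = V * S⁻¹ * V⁻¹ * (S * u) * s * w := by
          rw [hZ]; simp only [mul_assoc]
      _ = V * S⁻¹ * V⁻¹ * u * (S * s * w) := by rw [hSu]; simp only [mul_assoc]
      _ = V * S⁻¹ * (V⁻¹ * u * w) * S := by rw [← hS]; simp only [mul_assoc]
      _ = V * (S⁻¹ * w) * u * V⁻¹ * S := by rw [← hV']; simp only [mul_assoc]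
      _ = (V * s) * w * (S⁻¹ * u) * V⁻¹ * S := by rw [hS']; simp only [mul_assoc]
      _ = s * (V * w * u) * S⁻¹ * V⁻¹ * S := by rw [← hsV, hSu']; simp only [mul_assoc]
      _ = s * u * (w * Z) := by rw [← hV, hZ]; simp only [mul_assoc]
      _ = s * u * Z * w := by rw [hwZ]; simp only [mul_assoc]
  exact (mul_right_cancel key).symm

/-- On legs `K₁, K₂, L, L` the index 3 or 4 names the copy of `L` involved: `s` is the first
representation, `t` the second, `z` the braiding unitary with `K₂`, and `F`, `b` act on legs 34.
Since `F` commutes only with the product `z₃ * z₄`, a factor `z₄ * z₄⁻¹` is inserted first. After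
both representation conditions are used, the Yang–Baxter relation `hb` restores the order of the
`z`'s, and `ht` brings `t₃` to its place. -/
theorem braided_corepresentation_tensor {F b z₃ z₄ s₃ s₄ t₃ t₄ : G}
    (hF : F * z₃ * z₄ = z₃ * z₄ * F)
    (hb : b * z₄ * z₃ = z₃ * z₄ * b) (ht : b * z₄ * t₃ = t₃ * b * z₄)
    (hs₃ : F * s₃ = s₃ * b * s₄ * b⁻¹ * F) (ht₃ : F * t₃ = t₃ * b * t₄ * b⁻¹ * F)
    (hzs : z₄ * s₃ = s₃ * z₄) (hzs' : z₃ * s₄ = s₄ * z₃) (hts : t₃ * s₄ = s₄ * t₃) :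
    F * (z₃ * s₃ * z₃⁻¹ * t₃) =
      z₃ * s₃ * z₃⁻¹ * t₃ * b * (z₄ * s₄ * z₄⁻¹ * t₄) * b⁻¹ * F := by
  have hF' : F * z₄⁻¹ * z₃⁻¹ = z₄⁻¹ * z₃⁻¹ * F := by
    rw [mul_assoc, ← mul_inv_rev, mul_inv_eq_iff_eq_mul, mul_assoc, eq_inv_mul_iff_mul_eq,
      ← mul_assoc, hF]
  have hzs₄ : z₄⁻¹ * s₃ = s₃ * z₄⁻¹ := by
    rw [inv_mul_eq_iff_eq_mul, ← mul_assoc, eq_mul_inv_iff_mul_eq, hzs]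
  have hts' : z₄⁻¹ * b⁻¹ * t₃ = t₃ * z₄⁻¹ * b⁻¹ := by
    rw [mul_assoc t₃, ← mul_inv_rev, eq_mul_inv_iff_mul_eq, mul_assoc, inv_mul_eq_iff_eq_mul, 
      ← mul_assoc, ht, mul_assoc]
  have hb₁ : z₄ * b = z₃⁻¹ * b * z₄ * z₃ := by
    rw [mul_assoc, mul_assoc, eq_inv_mul_iff_mul_eq, ← mul_assoc, ← hb, mul_assoc]
  have hb₂ : b⁻¹ * z₄⁻¹ = z₃⁻¹ * z₄⁻¹ * b⁻¹ * z₃ := by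
    rw [← mul_inv_rev, hb₁]
    simp only [mul_inv_rev, inv_inv, mul_assoc]
  calc F * (z₃ * s₃ * z₃⁻¹ * t₃) = (F * z₃ * z₄) * (z₄⁻¹ * s₃) * z₃⁻¹ * t₃ := by
        simp only [mul_assoc, mul_inv_cancel_left]
    _ = z₃ * z₄ * (F * s₃) * z₄⁻¹ * z₃⁻¹ * t₃ := by
        rw [hF, hzs₄]
        simp only [mul_assoc]
    _ = z₃ * z₄ * s₃ * b * s₄ * b⁻¹ * (F * z₄⁻¹ * z₃⁻¹) * t₃ := by
        rw [hs₃]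
        simp only [mul_assoc]
    _ = z₃ * (z₄ * s₃) * b * s₄ * b⁻¹ * z₄⁻¹ * z₃⁻¹ * (F * t₃) := by
        rw [hF']
        simp only [mul_assoc]
    _ = z₃ * s₃ * (z₄ * b) * s₄ * (b⁻¹ * z₄⁻¹) * z₃⁻¹ * (t₃ * b * t₄ * b⁻¹ * F) := by
        rw [hzs, ht₃]
        simp only [mul_assoc]
    _ = z₃ * s₃ * z₃⁻¹ * b * z₄ * (z₃ * s₄) * z₃⁻¹ * (z₄⁻¹ * b⁻¹ * t₃) *
          (b * t₄ * b⁻¹ * F) := by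
        rw [hb₁, hb₂]
        simp only [mul_assoc, mul_inv_cancel_left]
    _ = z₃ * s₃ * z₃⁻¹ * b * z₄ * (t₃ * s₄) * z₄⁻¹ * (t₄ * b⁻¹ * F) := by
        rw [hzs', hts', hts]
        simp only [mul_assoc, mul_inv_cancel_left, inv_mul_cancel_left]
    _ = z₃ * s₃ * z₃⁻¹ * (b * z₄ * t₃) * s₄ * z₄⁻¹ * (t₄ * b⁻¹ * F) := by
        simp only [mul_assoc]
    _ = z₃ * s₃ * z₃⁻¹ * t₃ * b * (z₄ * s₄ * z₄⁻¹ * t₄) * b⁻¹ * F := by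
        rw [ht]
        simp only [mul_assoc]

/-- Passing `z` reverses the order of `s₂` and `u`, which puts `u` next to `s₁` as `ht₁` requires;
passing `z⁻¹` reverses it back for `ht₂`. -/
theorem braided_equivariant_tensor {s₁ s₂ u z t₁ t₂ : G} (hz : s₂ * u * z = z * u * s₂)
    (ht₁ : s₁ * u * t₁ = t₁ * s₁ * u) (ht₂ : s₂ * u * t₂ = t₂ * s₂ * u)
    (hs₁z : s₁ * z = z * s₁) (hs₁t : s₁ * t₂ = t₂ * s₁) (hs₂t : s₂ * t₁ = t₁ * s₂) :
    s₁ * s₂ * u * (z * t₁ * z⁻¹ * t₂) = z * t₁ * z⁻¹ * t₂ * (s₁ * s₂ * u) := by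
  have hz' : u * s₂ * z⁻¹ = z⁻¹ * s₂ * u := by
    rw [mul_inv_eq_iff_eq_mul, mul_assoc, mul_assoc, eq_inv_mul_iff_mul_eq]
    simpa only [mul_assoc] using hz.symm
  have hs₁z' : s₁ * z⁻¹ = z⁻¹ * s₁ := by
    rw [mul_inv_eq_iff_eq_mul, mul_assoc, hs₁z, inv_mul_cancel_left]
  calc s₁ * s₂ * u * (z * t₁ * z⁻¹ * t₂) = s₁ * (s₂ * u * z) * t₁ * z⁻¹ * t₂ := by
        simp only [mul_assoc]
    _ = (s₁ * z) * u * (s₂ * t₁) * z⁻¹ * t₂ := by rw [hz]; simp only [mul_assoc]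
    _ = z * (s₁ * u * t₁) * s₂ * z⁻¹ * t₂ := by rw [hs₁z, hs₂t]; simp only [mul_assoc]
    _ = z * t₁ * s₁ * (u * s₂ * z⁻¹) * t₂ := by rw [ht₁]; simp only [mul_assoc]
    _ = z * t₁ * (s₁ * z⁻¹) * (s₂ * u * t₂) := by rw [hz']; simp only [mul_assoc]
    _ = z * t₁ * z⁻¹ * (s₁ * t₂) * s₂ * u := by rw [ht₂, hs₁z']; simp only [mul_assoc]
    _ = z * t₁ * z⁻¹ * t₂ * (s₁ * s₂ * u) := by rw [hs₁t]; simp only [mul_assoc]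

end GroupIdentities

namespace Hilb

/-! ### Adjoints of insertions and dropping an idle leg -/

section Slices

variable {A B C A' B' C' X : Hilb.{u}}

theorem inner_tmul (a a' : A) (b b' : B) :
    inner ℂ (tmul a b) (tmul a' b') = inner ℂ a a' * inner ℂ b b' :=
  ((incl A B).inner_map_map _ _).trans (TensorProduct.inner_tmul _ _ _ _ _)

theorem dag_insr_tmul (b : B) (a : A) (b' : B) :
    (dag (insr A b)).clm (tmul a b') = inner ℂ b b' • a := by
  refine ext_inner_left ℂ fun x => ?_
  rw [inner_smul_right, mul_comm]
  exact (ContinuousLinearMap.adjoint_inner_right (insr A b).clm x (tmul a b')).trans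
    (inner_tmul x a b b')

theorem whiskerRight_dag_insr (f : A ⟶ A') (b : B) :
    f ▷ B ≫ dag (insr A' b) = dag (insr A b) ≫ f := by
  refine ext_tmul fun a b' => ?_
  simp only [comp_clm, ContinuousLinearMap.comp_apply, whiskerRight_tmul, dag_insr_tmul, map_smul]

/-- A vector of `A ⊗ B` is determined by its inner products with elementary tensors, and these can
be read off after applying the adjoint insertions. -/
theorem ext_dag_insr {f g : X ⟶ A ⊗ B}
    (h : ∀ b : B, f ≫ dag (insr A b) = g ≫ dag (insr A b)) : f = g := by
  ext x
  have key : innerSL ℂ (f.clm x) = innerSL ℂ (g.clm x) := clm_ext fun a b => by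
    have hb : (dag (insr A b)).clm (f.clm x) = (dag (insr A b)).clm (g.clm x) :=
      congrArg (fun k : X ⟶ A => k.clm x) (h b)
    have hf := ContinuousLinearMap.adjoint_inner_left (insr A b).clm a (f.clm x)
    have hg := ContinuousLinearMap.adjoint_inner_left (insr A b).clm a (g.clm x)
    exact hf.symm.trans ((congrArg (fun y => inner ℂ y a) hb).trans hg)
  exact ext_inner_right ℂ fun y => DFunLike.congr_fun key y

/-- Insertion of `b` is a multiple of an isometry, so its adjoint divided by `⟨b, b⟩` is a left
inverse. Dropping an idle leg rests on this, whence the condition that the leg is nonzero. -/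
theorem exists_retraction_insr (A : Hilb.{u}) {b : B} (hb : b ≠ 0) :
    ∃ r : A ⊗ B ⟶ A, insr A b ≫ r = 𝟙 A := by
  refine ⟨⟨(inner ℂ b b)⁻¹ • (dag (insr A b)).clm⟩, ?_⟩
  ext a
  change (inner ℂ b b)⁻¹ • (dag (insr A b)).clm (tmul a b) = a
  rw [dag_insr_tmul, smul_smul, inv_mul_cancel₀ (inner_self_ne_zero.mpr hb), one_smul]

variable [Nontrivial B]

theorem leg13_injective {f g : A ⊗ C ⟶ A' ⊗ C'} (h : leg13 B f = leg13 B g) : f = g := by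
  obtain ⟨b, hb⟩ := exists_ne (0 : B)
  obtain ⟨r, hr⟩ := exists_retraction_insr A' hb
  have hr' : insr A' b ▷ C' ≫ r ▷ C' = 𝟙 _ := by rw [← comp_whiskerRight, hr, id_whiskerRight]
  rw [← Category.comp_id f, ← Category.comp_id g, ← hr', ← reassoc_of% insr_leg13 f b, h,
    reassoc_of% insr_leg13 g b]

theorem leg23_injective {f g : A ⊗ C ⟶ A' ⊗ C'} (h : leg23 B f = leg23 B g) : f = g := by
  refine leg13_injective (B := B) ?_
  have := leg13_eq_leg23 (B := B) f
  rw [h, leg13_eq_leg23] at this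
  exact ((cancel_mono _).1 this).symm

theorem leg134_injective {D : Hilb.{u}} {f g : (A ⊗ C) ⊗ D ⟶ (A ⊗ C) ⊗ D}
    (h : leg134 B f = leg134 B g) : f = g := by
  obtain ⟨b, hb⟩ := exists_ne (0 : B)
  obtain ⟨r, hr⟩ := exists_retraction_insr A hb
  have hr' : insr A b ▷ C ▷ D ≫ r ▷ C ▷ D = 𝟙 _ := by
    rw [← comp_whiskerRight, ← comp_whiskerRight, hr, id_whiskerRight, id_whiskerRight]
  rw [← Category.comp_id f, ← Category.comp_id g, ← hr', ← reassoc_of% insr_leg134 f b, h,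
    reassoc_of% insr_leg134 g b]

end Slices

/-! ### Leg numbering as group homomorphisms -/

section Units

variable {A B C D : Hilb.{u}}

/-- A unitary operator as an invertible element of the endomorphism monoid. -/
noncomputable def IsUnitary.toUnits {f : A ⟶ A} (hf : IsUnitary f) : (End A)ˣ :=
  ⟨f, dag f, hf.dag_comp, hf.comp_dag⟩

/-- The leg numbering `f ↦ f₁₂` on invertible operators. -/
noncomputable def unit12 (C : Hilb.{u}) : (End (A ⊗ B))ˣ →* (End ((A ⊗ B) ⊗ C))ˣ :=
  Units.map
    { toFun := fun f => leg12 C f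
      map_one' := leg12_id
      map_mul' := fun f g => (leg12_comp g f).symm }

/-- The leg numbering `f ↦ f₁₃` on invertible operators. -/
noncomputable def unit13 (B : Hilb.{u}) : (End (A ⊗ C))ˣ →* (End ((A ⊗ B) ⊗ C))ˣ :=
  Units.map
    { toFun := fun f => leg13 B f
      map_one' := leg13_id
      map_mul' := fun f g => (leg13_comp g f).symm }

/-- The leg numbering `f ↦ f₂₃` on invertible operators. -/
noncomputable def unit23 (A : Hilb.{u}) : (End (B ⊗ C))ˣ →* (End ((A ⊗ B) ⊗ C))ˣ :=
  Units.map
    { toFun := fun f => leg23 A f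
      map_one' := leg23_id
      map_mul' := fun f g => (leg23_comp g f).symm }

theorem leg134_id : leg134 B (𝟙 ((A ⊗ C) ⊗ D)) = 𝟙 (((A ⊗ B) ⊗ C) ⊗ D) := by
  refine ext_insr_whiskerRight₂ fun b => ?_
  rw [insr_leg134, Category.comp_id, Category.id_comp]

theorem leg134_comp (f g : (A ⊗ C) ⊗ D ⟶ (A ⊗ C) ⊗ D) :
    leg134 B f ≫ leg134 B g = leg134 B (f ≫ g) := by
  refine ext_insr_whiskerRight₂ fun b => ?_
  rw [reassoc_of% insr_leg134 f b, insr_leg134, insr_leg134, Category.assoc]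

theorem leg234_id : leg234 A (𝟙 ((B ⊗ C) ⊗ D)) = 𝟙 (((A ⊗ B) ⊗ C) ⊗ D) := by
  refine ext_insl_whiskerRight₂ fun b => ?_
  rw [insl_leg234, Category.comp_id, Category.id_comp]

theorem leg234_comp (f g : (B ⊗ C) ⊗ D ⟶ (B ⊗ C) ⊗ D) :
    leg234 A f ≫ leg234 A g = leg234 A (f ≫ g) := by
  refine ext_insl_whiskerRight₂ fun b => ?_
  rw [reassoc_of% insl_leg234 f b, insl_leg234, insl_leg234, Category.assoc]

/-- The leg numbering `f ↦ f₁₃₄` on invertible operators. -/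
noncomputable def unit134 (B : Hilb.{u}) :
    (End ((A ⊗ C) ⊗ D))ˣ →* (End (((A ⊗ B) ⊗ C) ⊗ D))ˣ :=
  Units.map
    { toFun := fun f => leg134 B f
      map_one' := leg134_id
      map_mul' := fun f g => (leg134_comp g f).symm }

/-- The leg numbering `f ↦ f₂₃₄` on invertible operators. -/
noncomputable def unit234 (A : Hilb.{u}) :
    (End ((B ⊗ C) ⊗ D))ˣ →* (End (((A ⊗ B) ⊗ C) ⊗ D))ˣ :=
  Units.map
    { toFun := fun f => leg234 A f
      map_one' := leg234_id
      map_mul' := fun f g => (leg234_comp g f).symm }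

theorem unit124_unit12 (f : (End (A ⊗ B))ˣ) :
    unit13 C (unit12 D f) = unit12 D (unit12 C f) := Units.ext (leg124_leg12 _)

theorem unit134_unit12 (f : (End (A ⊗ C))ˣ) :
    unit134 B (unit12 D f) = unit12 D (unit13 B f) := Units.ext (leg134_leg12 _)

theorem unit134_unit13 (f : (End (A ⊗ D))ˣ) :
    unit134 B (unit13 C f) = unit13 C (unit13 B f) := Units.ext (leg134_leg13 _)

theorem unit134_unit23 (f : (End (C ⊗ D))ˣ) :
    unit134 B (unit23 A f) = unit23 (A ⊗ B) f := Units.ext (leg134_leg23 _)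

theorem unit234_unit12 (f : (End (B ⊗ C))ˣ) :
    unit234 A (unit12 D f) = unit12 D (unit23 A f) := Units.ext (leg234_leg12 _)

theorem unit234_unit13 (f : (End (B ⊗ D))ˣ) :
    unit234 A (unit13 C f) = unit13 C (unit23 A f) := Units.ext (leg234_leg13 _)

theorem unit234_unit23 (f : (End (C ⊗ D))ˣ) :
    unit234 A (unit23 B f) = unit23 (A ⊗ B) f := Units.ext (leg234_leg23 _)

theorem commute_unit12_unit34 (f : (End (A ⊗ B))ˣ) (g : (End (C ⊗ D))ˣ) :
    Commute (unit12 D (unit12 C f)) (unit23 (A ⊗ B) g) :=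
  Units.ext (leg12_comp_leg34 _ _).symm

theorem commute_unit13_unit24 (f : (End (A ⊗ C))ˣ) (g : (End (B ⊗ D))ˣ) :
    Commute (unit12 D (unit13 B f)) (unit13 C (unit23 A g)) :=
  Units.ext (leg13_comp_leg24 _ _).symm

theorem commute_unit14_unit23 (f : (End (A ⊗ D))ˣ) (g : (End (B ⊗ C))ˣ) :
    Commute (unit13 C (unit13 B f)) (unit12 D (unit23 A g)) :=
  Units.ext (leg14_comp_leg23 _ _).symm

theorem unit13_injective [Nontrivial B] :
    Function.Injective (unit13 B : (End (A ⊗ C))ˣ →* _) := fun _ _ h =>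
  Units.ext (leg13_injective (congrArg Units.val h))

theorem unit134_injective [Nontrivial B] :
    Function.Injective (unit134 B : (End ((A ⊗ C) ⊗ D))ˣ →* _) := fun _ _ h =>
  Units.ext (leg134_injective (congrArg Units.val h))

end Units

end Hilb

namespace Hilb

/-! ### Properties of the braiding unitary and of tensor products, in leg notation -/

section LegIdentities

variable {H L K K₁ K₂ : Hilb.{u}} {w : (End (H ⊗ H))ˣ} {u : (End (L ⊗ H))ˣ}
  {v : (End (H ⊗ L))ˣ} {f : (End (L ⊗ L))ˣ} {s : (End (K ⊗ H))ˣ} {z t : (End (K ⊗ L))ˣ}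
  {s₁ : (End (K₁ ⊗ H))ˣ} {s₂ : (End (K₂ ⊗ H))ˣ} {z₁ t₁ : (End (K₁ ⊗ L))ˣ}
  {z₂ t₂ : (End (K₂ ⊗ L))ˣ} {b : (End (L ⊗ L))ˣ}

/-- The two given conditions are placed on legs 134 and 234. What remains is that `s₁` on legs 14
commutes with `s₂` on legs 23. -/
theorem rightRep_tensor
    (h₁ : unit23 K₁ w * unit12 H s₁ = unit12 H s₁ * unit13 H s₁ * unit23 K₁ w)
    (h₂ : unit23 K₂ w * unit12 H s₂ = unit12 H s₂ * unit13 H s₂ * unit23 K₂ w) :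
    unit23 (K₁ ⊗ K₂) w * unit12 H (unit13 K₂ s₁ * unit23 K₁ s₂) =
      unit12 H (unit13 K₂ s₁ * unit23 K₁ s₂) * unit13 H (unit13 K₂ s₁ * unit23 K₁ s₂) *
        unit23 (K₁ ⊗ K₂) w := by
  have e₁ := congrArg (unit134 K₂) h₁
  have e₂ := congrArg (unit234 K₁) h₂
  simp only [map_mul, unit134_unit12, unit134_unit13, unit134_unit23, unit234_unit12,
    unit234_unit13, unit234_unit23] at e₁ e₂ ⊢
  have c := (commute_unit14_unit23 s₁ s₂).eq
  rw [← mul_assoc, e₁, mul_assoc _ (unit23 (K₁ ⊗ K₂) w), e₂]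
  simp only [← mul_assoc]
  rw [mul_assoc _ (unit13 H (unit13 K₂ s₁)), c]
  simp only [← mul_assoc]

/-- One hexagon identity. In the product of the two commutators, `s₂` on legs 23 moves past `z₁` on
legs 14, and the inner `v⁻¹ * v` cancels. -/
theorem braiding_tensor
    (h₁ : unit13 H z₁ = unit23 K₁ v * unit12 L s₁⁻¹ * unit23 K₁ v⁻¹ * unit12 L s₁)
    (h₂ : unit13 H z₂ = unit23 K₂ v * unit12 L s₂⁻¹ * unit23 K₂ v⁻¹ * unit12 L s₂) :
    unit13 H (unit23 K₁ z₂ * unit13 K₂ z₁) =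
      unit23 (K₁ ⊗ K₂) v * unit12 L (unit13 K₂ s₁ * unit23 K₁ s₂)⁻¹ * unit23 (K₁ ⊗ K₂) v⁻¹ *
        unit12 L (unit13 K₂ s₁ * unit23 K₁ s₂) := by
  have e₁ := congrArg (unit134 K₂) h₁
  have e₂ := congrArg (unit234 K₁) h₂
  simp only [map_mul, map_inv, unit134_unit12, unit134_unit13, unit134_unit23, unit234_unit12,
    unit234_unit13, unit234_unit23, mul_inv_rev] at e₁ e₂ ⊢
  have c := (commute_unit14_unit23 z₁ s₂).eq
  rw [e₂, mul_assoc, ← c, e₁]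
  simp only [mul_assoc, inv_mul_cancel_left]

/-- The braiding is an intertwiner of right representations of `w`; this is where Drinfeld
compatibility `hd` enters. An extra leg `H` is inserted as second leg so that `hz` can be
substituted for `z`. -/
theorem braiding_equivariant [Nontrivial H]
    (hs : unit23 K w * unit12 H s = unit12 H s * unit13 H s * unit23 K w)
    (hd : unit23 H u * unit13 L w * unit12 H v = unit12 H v * unit13 L w * unit23 H u)
    (hz : unit13 H z = unit23 K v * unit12 L s⁻¹ * unit23 K v⁻¹ * unit12 L s) :
    unit13 L s * unit23 K u * unit12 H z = unit12 H z * unit23 K u * unit13 L s := by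
  refine unit134_injective (B := H) ?_
  have e₁ := congrArg (unit13 L) hs
  have e₂ := congrArg (unit234 K) hd
  have e₃ := congrArg (unit12 H) hz
  simp only [map_mul, map_inv, unit134_unit12, unit134_unit13, unit134_unit23, unit234_unit12,
    unit234_unit13, unit234_unit23, unit124_unit12] at e₁ e₂ e₃ ⊢
  exact commutator_intertwines e₂ e₁ e₃ (commute_unit13_unit24 z w).symm.eq
    (commute_unit14_unit23 s v).eq (commute_unit12_unit34 s u).eq

/-- The product of the two copies of `z` is again a commutator, with `v` replaced by the tensor
product left representation on `L ⊗ L`. By `hf` the operator `f` commutes with that representation,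
and it shares no leg with `s`. -/
theorem braiding_natural_left [Nontrivial H]
    (hf : unit13 L v * unit12 L v * unit23 H f = unit23 H f * unit13 L v * unit12 L v)
    (hz : unit13 H z = unit23 K v * unit12 L s⁻¹ * unit23 K v⁻¹ * unit12 L s) :
    unit23 K f * unit12 L z * unit13 L z = unit12 L z * unit13 L z * unit23 K f := by
  refine unit134_injective (B := H) ?_
  have e₁ := congrArg (unit12 L) hz
  have e₂ := congrArg (unit13 L) hz
  have e₃ := congrArg (unit234 K) hf
  simp only [map_mul, map_inv, unit134_unit12, unit134_unit13, unit134_unit23, unit234_unit12,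
    unit234_unit13, unit234_unit23, unit124_unit12] at e₁ e₂ e₃ ⊢
  have c := (commute_unit13_unit24 z v).eq
  have e : unit12 L (unit13 H z) * unit13 L (unit13 H z) =
      unit13 L (unit23 K v) * unit12 L (unit23 K v) * (unit12 L (unit12 L s))⁻¹ *
        (unit13 L (unit23 K v) * unit12 L (unit23 K v))⁻¹ * unit12 L (unit12 L s) := by
    rw [e₂]
    simp only [← mul_assoc]
    rw [c, e₁]
    simp only [mul_inv_rev, mul_assoc, mul_inv_cancel_left]
  have hv : Commute (unit23 (K ⊗ H) f) (unit13 L (unit23 K v) * unit12 L (unit23 K v)) := by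
    rw [Commute, SemiconjBy, e₃, mul_assoc]
  have hs : Commute (unit23 (K ⊗ H) f) (unit12 L (unit12 L s)) :=
    (commute_unit12_unit34 s f).symm
  rw [mul_assoc, e]
  exact ((hv.mul_right hs.inv_right).mul_right hv.inv_right).mul_right hs

/-- By `braiding_tensor`, `b₂₃ z₁₃` is the braiding unitary of the tensor product of `s` and `u`.
The equation is its naturality under `z`, which by `he` interchanges the two orders in which `s` and
`u` can be multiplied. -/
theorem yang_baxter [Nontrivial H]
    (he : unit13 L s * unit23 K u * unit12 H z = unit12 H z * unit23 K u * unit13 L s)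
    (hz : unit13 H z = unit23 K v * unit12 L s⁻¹ * unit23 K v⁻¹ * unit12 L s)
    (hb : unit13 H b = unit23 L v * unit12 L u⁻¹ * unit23 L v⁻¹ * unit12 L u) :
    unit23 K b * unit13 L z * unit12 L z = unit12 L z * unit13 L z * unit23 K b := by
  refine unit13_injective (B := H) ?_
  have e := braiding_tensor hz hb
  have e₀ := congrArg (unit12 L) he
  have e₁ := congrArg (unit134 L) hz
  have e₂ := congrArg (unit234 K) hb
  simp only [map_mul, map_inv, unit134_unit12, unit134_unit13, unit134_unit23, unit234_unit12,
    unit234_unit13, unit234_unit23, unit124_unit12, mul_inv_rev] at e e₀ e₁ e₂ ⊢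
  have c₁ := (commute_unit13_unit24 s b).eq
  have c₂ := (commute_unit12_unit34 z v).eq
  have c₂' := (commute_unit12_unit34 z v).inv_right.eq
  rw [e]
  -- The legs are `K, L, H, L`: here `x` is `z₁₂`, `y` is `s₁₃`, `q` is `u₂₃` and `r` is `v₃₄`.
  generalize unit12 L (unit12 H z) = x at *
  generalize unit12 L (unit13 L s) = y at *
  generalize unit12 L (unit23 K u) = q at *
  generalize unit23 (K ⊗ L) v = r at *
  generalize unit13 H (unit13 L z) = z₁₄ at *
  generalize unit13 H (unit23 K b) = b₂₄ at *
  have e₀' : q⁻¹ * y⁻¹ * x = x * y⁻¹ * q⁻¹ := by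
    have := congrArg (fun g => x * g⁻¹ * x) e₀
    simpa only [mul_inv_rev, mul_assoc, mul_inv_cancel_left, inv_mul_cancel_left, inv_mul_cancel,
      mul_one] using this
  have e₃ : q⁻¹ * r⁻¹ * q = r⁻¹ * b₂₄ := by
    rw [e₂]
    simp only [mul_assoc, inv_mul_cancel_left]
  calc r * (q⁻¹ * y⁻¹) * r⁻¹ * (y * q) * x = r * (q⁻¹ * y⁻¹) * r⁻¹ * (y * q * x) := by
        simp only [mul_assoc]
    _ = r * (q⁻¹ * y⁻¹) * (x * r⁻¹) * q * y := by rw [e₀, c₂']; simp only [mul_assoc]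
    _ = r * (q⁻¹ * y⁻¹ * x) * r⁻¹ * q * y := by simp only [mul_assoc]
    _ = (x * r) * y⁻¹ * (q⁻¹ * r⁻¹ * q) * y := by rw [e₀', c₂]; simp only [mul_assoc]
    _ = x * r * y⁻¹ * r⁻¹ * (y * b₂₄) := by rw [e₃, c₁]; simp only [mul_assoc]
    _ = x * z₁₄ * b₂₄ := by rw [e₁]; simp only [mul_assoc]

/-- By `braiding_tensor`, `b₂₃ z₁₃` is built from `v` and the tensor product of `s` and `u`. The
operator `t` commutes with the latter by `ht` and with `v` because their legs are disjoint. -/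
theorem braiding_natural_right [Nontrivial H]
    (ht : unit13 L s * unit23 K u * unit12 H t = unit12 H t * unit13 L s * unit23 K u)
    (hz : unit13 H z = unit23 K v * unit12 L s⁻¹ * unit23 K v⁻¹ * unit12 L s)
    (hb : unit13 H b = unit23 L v * unit12 L u⁻¹ * unit23 L v⁻¹ * unit12 L u) :
    unit23 K b * unit13 L z * unit12 L t = unit12 L t * unit23 K b * unit13 L z := by
  refine unit13_injective (B := H) ?_
  have e := braiding_tensor hz hb
  have e₀ := congrArg (unit12 L) ht
  rw [map_mul, mul_assoc, map_mul (unit13 H) (unit12 L t), e]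
  simp only [map_mul, map_inv, unit124_unit12] at e₀ ⊢
  have hv : Commute (unit12 L (unit12 H t)) (unit23 (K ⊗ L) v) := commute_unit12_unit34 t v
  have hsu : Commute (unit12 L (unit12 H t)) (unit12 L (unit13 L s) * unit12 L (unit23 K u)) := by
    rw [Commute, SemiconjBy, e₀, mul_assoc]
  exact (((hv.mul_right hsu.inv_right).mul_right hv.inv_right).mul_right hsu).symm

theorem equivariant_tensor
    (hz : unit13 L s₂ * unit23 K₂ u * unit12 H z₂ = unit12 H z₂ * unit23 K₂ u * unit13 L s₂)
    (ht₁ : unit13 L s₁ * unit23 K₁ u * unit12 H t₁ = unit12 H t₁ * unit13 L s₁ * unit23 K₁ u)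
    (ht₂ : unit13 L s₂ * unit23 K₂ u * unit12 H t₂ = unit12 H t₂ * unit13 L s₂ * unit23 K₂ u) :
    unit13 L (unit13 K₂ s₁ * unit23 K₁ s₂) * unit23 (K₁ ⊗ K₂) u *
        unit12 H (unit23 K₁ z₂ * unit13 K₂ t₁ * unit23 K₁ z₂⁻¹ * unit23 K₁ t₂) =
      unit12 H (unit23 K₁ z₂ * unit13 K₂ t₁ * unit23 K₁ z₂⁻¹ * unit23 K₁ t₂) *
        (unit13 L (unit13 K₂ s₁ * unit23 K₁ s₂) * unit23 (K₁ ⊗ K₂) u) := by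
  have e₀ := congrArg (unit234 K₁) hz
  have e₁ := congrArg (unit134 K₂) ht₁
  have e₂ := congrArg (unit234 K₁) ht₂
  simp only [map_mul, map_inv, unit134_unit12, unit134_unit13, unit134_unit23, unit234_unit12,
    unit234_unit13, unit234_unit23] at e₀ e₁ e₂ ⊢
  exact braided_equivariant_tensor e₀ e₁ e₂ (commute_unit14_unit23 s₁ z₂).eq
    (commute_unit14_unit23 s₁ t₂).eq (commute_unit13_unit24 t₁ s₂).symm.eq

theorem braidedRep_tensor
    (hf : unit23 K₂ f * unit12 L z₂ * unit13 L z₂ = unit12 L z₂ * unit13 L z₂ * unit23 K₂ f)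
    (hb : unit23 K₂ b * unit13 L z₂ * unit12 L z₂ = unit12 L z₂ * unit13 L z₂ * unit23 K₂ b)
    (ht : unit23 K₂ b * unit13 L z₂ * unit12 L t₂ = unit12 L t₂ * unit23 K₂ b * unit13 L z₂)
    (ht₁ : unit23 K₁ f * unit12 L t₁ =
      unit12 L t₁ * unit23 K₁ b * unit13 L t₁ * unit23 K₁ b⁻¹ * unit23 K₁ f)
    (ht₂ : unit23 K₂ f * unit12 L t₂ =
      unit12 L t₂ * unit23 K₂ b * unit13 L t₂ * unit23 K₂ b⁻¹ * unit23 K₂ f) :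
    unit23 (K₁ ⊗ K₂) f *
        unit12 L (unit23 K₁ z₂ * unit13 K₂ t₁ * unit23 K₁ z₂⁻¹ * unit23 K₁ t₂) =
      unit12 L (unit23 K₁ z₂ * unit13 K₂ t₁ * unit23 K₁ z₂⁻¹ * unit23 K₁ t₂) *
        unit23 (K₁ ⊗ K₂) b *
        unit13 L (unit23 K₁ z₂ * unit13 K₂ t₁ * unit23 K₁ z₂⁻¹ * unit23 K₁ t₂) *
        unit23 (K₁ ⊗ K₂) b⁻¹ * unit23 (K₁ ⊗ K₂) f := by
  have e₁ := congrArg (unit234 K₁) hf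
  have e₂ := congrArg (unit234 K₁) hb
  have e₃ := congrArg (unit234 K₁) ht
  have e₄ := congrArg (unit134 K₂) ht₁
  have e₅ := congrArg (unit234 K₁) ht₂
  simp only [map_mul, map_inv, unit134_unit12, unit134_unit13, unit134_unit23, unit234_unit12,
    unit234_unit13, unit234_unit23] at e₁ e₂ e₃ e₄ e₅ ⊢
  exact braided_corepresentation_tensor e₁ e₂ e₃ e₄ e₅ (commute_unit13_unit24 t₁ z₂).symm.eq
    (commute_unit14_unit23 t₁ z₂).symm.eq (commute_unit14_unit23 t₁ t₂).symm.eq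

end LegIdentities

end Hilb

namespace Hilb

/-! ### Unitarity of leg operators -/

section Unitary

variable {A B C D : Hilb.{u}}

theorem dag_whiskerRight (f : A ⟶ B) (C : Hilb.{u}) : dag (f ▷ C) = dag f ▷ C := by
  refine ext_dag_insr fun c => ?_
  rw [whiskerRight_dag_insr, ← Hilb.dag_comp, ← Hilb.dag_comp, insr_whiskerRight]

theorem dag_dag (f : A ⟶ B) : dag (dag f) = f :=
  Hom.ext (ContinuousLinearMap.adjoint_adjoint f.clm)

theorem IsUnitary.whiskerRight {f : A ⟶ B} (hf : IsUnitary f) (C : Hilb.{u}) :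
    IsUnitary (f ▷ C) where
  comp_dag := by rw [dag_whiskerRight, ← comp_whiskerRight, hf.comp_dag, id_whiskerRight]
  dag_comp := by rw [dag_whiskerRight, ← comp_whiskerRight, hf.dag_comp, id_whiskerRight]

theorem IsUnitary.dag {f : A ⟶ B} (hf : IsUnitary f) : IsUnitary (dag f) where
  comp_dag := by rw [dag_dag, hf.dag_comp]
  dag_comp := by rw [dag_dag, hf.comp_dag]

theorem IsUnitary.dag_eq {f : A ⟶ B} (hf : IsUnitary f) {g : B ⟶ A} (h : f ≫ g = 𝟙 A) :
    Hilb.dag f = g := by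
  rw [← Category.comp_id (Hilb.dag f), ← h, ← Category.assoc, hf.dag_comp, Category.id_comp]

theorem isUnitary_associator (A B C : Hilb.{u}) : IsUnitary (α_ A B C).hom :=
  isUnitary_isoOfIsometry _

theorem dag_braiding (A B : Hilb.{u}) : dag (β_ A B).hom = (β_ B A).hom :=
  (isUnitary_braiding A B).dag_eq (SymmetricCategory.symmetry A B)

theorem IsUnitary.whiskerLeft {f : B ⟶ C} (hf : IsUnitary f) (A : Hilb.{u}) :
    IsUnitary (A ◁ f) := by
  have h : A ◁ f = (β_ A B).hom ≫ f ▷ A ≫ (β_ C A).hom := by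
    rw [← BraidedCategory.braiding_naturality_right_assoc, SymmetricCategory.symmetry,
      Category.comp_id]
  rw [h]
  exact (isUnitary_braiding A B).comp ((hf.whiskerRight A).comp (isUnitary_braiding C A))

theorem IsUnitary.leg12 {f : A ⊗ B ⟶ A ⊗ B} (hf : IsUnitary f) : IsUnitary (leg12 C f) :=
  hf.whiskerRight C

theorem IsUnitary.leg23 {B' C' : Hilb.{u}} {f : B ⊗ C ⟶ B' ⊗ C'} (hf : IsUnitary f) :
    IsUnitary (leg23 A f) := by
  have h : (α_ A B' C').inv = Hilb.dag (α_ A B' C').hom :=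
    ((isUnitary_associator A B' C').dag_eq (Iso.hom_inv_id _)).symm
  rw [Hilb.leg23, h]
  exact ((isUnitary_associator A B C).comp (hf.whiskerLeft A)).comp
    (isUnitary_associator A B' C').dag

theorem IsUnitary.leg13 {f : A ⊗ C ⟶ A ⊗ C} (hf : IsUnitary f) : IsUnitary (leg13 B f) :=
  ((isUnitary_braiding B C).leg23.comp hf.leg12).comp (isUnitary_braiding C B).leg23

theorem IsUnitary.dag_leg23 {f : B ⊗ C ⟶ B ⊗ C} (hf : IsUnitary f) :
    Hilb.dag (Hilb.leg23 A f) = Hilb.leg23 A (Hilb.dag f) :=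
  hf.leg23.dag_eq (by rw [leg23_comp, hf.comp_dag, leg23_id])

theorem IsUnitary.dag_leg13 {f : A ⊗ C ⟶ A ⊗ C} (hf : IsUnitary f) :
    Hilb.dag (Hilb.leg13 B f) = Hilb.leg13 B (Hilb.dag f) :=
  hf.leg13.dag_eq (by rw [leg13_comp, hf.comp_dag, leg13_id])

end Unitary

/-! ### Uniqueness and multiplicativity of the braiding unitary -/

section Braiding

variable {H L K K₁ K₂ : Hilb.{u}} {V : H ⊗ L ⟶ H ⊗ L} {S : K ⊗ H ⟶ K ⊗ H}

theorem IsBraidingUnitary.units_eq {Z : K ⊗ L ⟶ K ⊗ L} (h : IsBraidingUnitary V S Z)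
    (hV : IsUnitary V) (hS : IsUnitary S) :
    unit13 H h.unitary.toUnits = unit23 K hV.toUnits * unit12 L hS.toUnits⁻¹ *
      unit23 K hV.toUnits⁻¹ * unit12 L hS.toUnits := by
  -- Iterated `∘ₒ` brackets to the right; after rebracketing, products of units agree with it
  -- definitionally, since multiplication in `End` is in operator order.
  simp only [mul_assoc]
  exact Units.ext h.eq

/-- Uniqueness lets the unitary picked by choice be replaced by an explicit one. -/
theorem braidZ_eq [Nontrivial H] {Z : K ⊗ L ⟶ K ⊗ L} (h : IsBraidingUnitary V S Z) :
    braidZ V S = Z :=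
  leg13_injective ((braidZ_spec ⟨Z, h⟩).eq.trans h.eq.symm)

/-- The flips contained in the braiding operators are exactly those that turn `T₁₂` into `T₁₃`.
Flips thus disappear from the tensor product and from the braided pentagon conditions. -/
theorem leg23_braid_conj (V : H ⊗ L ⟶ H ⊗ L) (S : K ⊗ H ⟶ K ⊗ H) (T : K₁ ⊗ L ⟶ K₁ ⊗ L) :
    leg23 K₁ (dualBraid V S) ≫ leg12 K T ≫ leg23 K₁ (braid V S) =
      leg23 K₁ (dag (braidZ V S)) ≫ leg13 K T ≫ leg23 K₁ (braidZ V S) := by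
  simp only [dualBraid, braid, Hilb.dag_comp, dag_braiding, ← leg23_comp, leg13, Category.assoc]

theorem tensorT_eq (V : H ⊗ L ⟶ H ⊗ L) (T₁ : K₁ ⊗ L ⟶ K₁ ⊗ L) (S₂ : K₂ ⊗ H ⟶ K₂ ⊗ H)
    (T₂ : K₂ ⊗ L ⟶ K₂ ⊗ L) :
    tensorT V T₁ S₂ T₂ = leg23 K₁ T₂ ≫ leg23 K₁ (dag (braidZ V S₂)) ≫ leg13 K₂ T₁ ≫
      leg23 K₁ (braidZ V S₂) := by
  rw [← leg23_braid_conj, tensorT]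
  simp only [Category.assoc]

theorem isBraidingUnitary_tensorS {S₁ : K₁ ⊗ H ⟶ K₁ ⊗ H} {S₂ : K₂ ⊗ H ⟶ K₂ ⊗ H}
    {Z₁ : K₁ ⊗ L ⟶ K₁ ⊗ L} {Z₂ : K₂ ⊗ L ⟶ K₂ ⊗ L} (hV : IsUnitary V) (hS₁ : IsUnitary S₁)
    (hS₂ : IsUnitary S₂) (h₁ : IsBraidingUnitary V S₁ Z₁) (h₂ : IsBraidingUnitary V S₂ Z₂) :
    IsBraidingUnitary V (tensorS S₁ S₂) (leg23 K₁ Z₂ ∘ₒ leg13 K₂ Z₁) where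
  unitary := h₁.unitary.leg13.comp h₂.unitary.leg23
  eq := by
    have hS : IsUnitary (tensorS S₁ S₂) := hS₂.leg23.comp hS₁.leg13
    have hs : hS.toUnits = unit13 K₂ hS₁.toUnits * unit23 K₁ hS₂.toUnits := Units.ext rfl
    have h := braiding_tensor (h₁.units_eq hV hS₁) (h₂.units_eq hV hS₂)
    rw [← hs] at h
    simp only [mul_assoc] at h
    exact congrArg Units.val h

end Braiding

end Hilb

/-! ### The tensor product of representations is a representation -/

namespace BraidedMultUnitary


variable {H L : Hilb.{u}} (B : BraidedMultUnitary H L)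

theorem isBraidingUnitary_tensor (x y : B.Rep) :
    IsBraidingUnitary B.V (tensorS x.S y.S)
      (leg23 x.K (braidZ B.V y.S) ∘ₒ leg13 y.K (braidZ B.V x.S)) :=
  isBraidingUnitary_tensorS B.V_rep.unitary x.isRep.S_rep.unitary y.isRep.S_rep.unitary
    (braidZ_spec x.isRep.S_braid) (braidZ_spec y.isRep.S_braid)

theorem T_rep_iff {K : Hilb.{u}} (T : K ⊗ L ⟶ K ⊗ L) :
    (leg23 K B.F ∘ₒ leg12 L T = leg12 L T ∘ₒ leg23 K (braid B.V B.U) ∘ₒ leg12 L T ∘ₒ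
      leg23 K (dualBraid B.V B.U) ∘ₒ leg23 K B.F) ↔
    leg23 K B.F ∘ₒ leg12 L T = leg12 L T ∘ₒ leg23 K (braidZ B.V B.U) ∘ₒ leg13 L T ∘ₒ
      leg23 K (dag (braidZ B.V B.U)) ∘ₒ leg23 K B.F := by
  have h := leg23_braid_conj B.V B.U T
  have h' : leg12 L T ∘ₒ leg23 K (braid B.V B.U) ∘ₒ leg12 L T ∘ₒ
      leg23 K (dualBraid B.V B.U) ∘ₒ leg23 K B.F = leg23 K B.F ≫ (leg23 K (dualBraid B.V B.U) ≫
        leg12 L T ≫ leg23 K (braid B.V B.U)) ≫ leg12 L T := by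
    simp only [Category.assoc]
  rw [h', h]
  simp only [Category.assoc]

theorem isRep_tensor [Nontrivial H] (x y : B.Rep) :
    B.IsRep (tensorS x.S y.S) (tensorT B.V x.T y.S y.T) := by
  have hV := B.V_rep.unitary
  have hU := B.U_rep.unitary
  have hW := B.W_mult.unitary
  have hF := B.F_unitary
  have hS₁ := x.isRep.S_rep.unitary
  have hS₂ := y.isRep.S_rep.unitary
  have hT₁ := x.isRep.T_unitary
  have hT₂ := y.isRep.T_unitary
  have hZ := braidZ_spec y.isRep.S_braid
  have hb := braidZ_spec B.U_braid
  have hS : IsUnitary (tensorS x.S y.S) := hS₂.leg23.comp hS₁.leg13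
  have hT : IsUnitary (tensorT B.V x.T y.S y.T) := by
    rw [tensorT_eq]
    exact hT₂.leg23.comp (hZ.unitary.dag.leg23.comp (hT₁.leg13.comp hZ.unitary.leg23))
  have hs : hS.toUnits = unit13 y.K hS₁.toUnits * unit23 x.K hS₂.toUnits := Units.ext rfl
  have ht : hT.toUnits = unit23 x.K hZ.unitary.toUnits * unit13 y.K hT₁.toUnits *
      unit23 x.K hZ.unitary.toUnits⁻¹ * unit23 x.K hT₂.toUnits :=
    Units.ext (tensorT_eq _ _ _ _)
  have rep (r : B.Rep) : unit23 r.K hW.toUnits * unit12 H r.isRep.S_rep.unitary.toUnits =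
      unit12 H r.isRep.S_rep.unitary.toUnits * unit13 H r.isRep.S_rep.unitary.toUnits *
        unit23 r.K hW.toUnits := by
    rw [mul_assoc]
    exact Units.ext r.isRep.S_rep.rep
  have equi (r : B.Rep) : unit13 L r.isRep.S_rep.unitary.toUnits * unit23 r.K hU.toUnits *
        unit12 H r.isRep.T_unitary.toUnits = unit12 H r.isRep.T_unitary.toUnits *
        unit13 L r.isRep.S_rep.unitary.toUnits * unit23 r.K hU.toUnits := by
    simp only [mul_assoc]
    exact Units.ext r.isRep.T_equivariant
  have brep (r : B.Rep) : unit23 r.K hF.toUnits * unit12 L r.isRep.T_unitary.toUnits =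
      unit12 L r.isRep.T_unitary.toUnits * unit23 r.K hb.unitary.toUnits *
        unit13 L r.isRep.T_unitary.toUnits * unit23 r.K hb.unitary.toUnits⁻¹ *
          unit23 r.K hF.toUnits := by
    simp only [mul_assoc]
    exact Units.ext ((B.T_rep_iff r.T).1 r.isRep.T_rep)
  have drinfeld : unit23 H hU.toUnits * unit13 L hW.toUnits * unit12 H hV.toUnits =
      unit12 H hV.toUnits * unit13 L hW.toUnits * unit23 H hU.toUnits := by
    simp only [mul_assoc]
    exact Units.ext B.drinfeld
  have F_V : unit13 L hV.toUnits * unit12 L hV.toUnits * unit23 H hF.toUnits =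
      unit23 H hF.toUnits * unit13 L hV.toUnits * unit12 L hV.toUnits := by
    simp only [mul_assoc]
    exact Units.ext B.F_V
  have z_eq := hZ.units_eq hV hS₂
  have b_eq := hb.units_eq hV hU
  have z_equi := braiding_equivariant (rep y) drinfeld z_eq
  refine ⟨⟨hS, ?_⟩, ⟨_, B.isBraidingUnitary_tensor x y⟩, hT, ?_, (B.T_rep_iff _).2 ?_⟩
  · have h := rightRep_tensor (rep x) (rep y)
    rw [← hs, mul_assoc] at h
    exact congrArg Units.val h
  · have h := equivariant_tensor z_equi (equi x) (equi y)
    rw [← hs, ← ht, mul_assoc] at h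
    exact congrArg Units.val h
  · have h := braidedRep_tensor (braiding_natural_left F_V z_eq) (yang_baxter z_equi z_eq b_eq)
      (braiding_natural_right (equi y) z_eq b_eq) (brep x) (brep y)
    rw [← ht] at h
    simp only [mul_assoc] at h
    exact congrArg Units.val h

end BraidedMultUnitary

namespace Hilb

/-! ### Associators, unit transformations and naturality of the braiding -/

section Intertwiners

variable {A B C D H L K K' : Hilb.{u}}

theorem IsUnitary.dag_intertwines {f : A ⟶ A} {g : B ⟶ B} (hf : IsUnitary f) (hg : IsUnitary g)
    {a : A ⟶ B} (h : f ≫ a = a ≫ g) : Hilb.dag f ≫ a = a ≫ Hilb.dag g := by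
  have := congrArg (fun k => Hilb.dag f ≫ k ≫ Hilb.dag g) h
  simp only [Category.assoc, hg.comp_dag, Category.comp_id] at this
  rw [← this, reassoc_of% hf.dag_comp]

/-- Fixing a vector in each of the two idle legs reduces both sides to `f`. -/
theorem whiskerRight_leg13_associator (f : A ⊗ D ⟶ A ⊗ D) :
    (α_ A B C).hom ▷ D ≫ leg13 (B ⊗ C) f =
      leg13 C (leg13 B f) ≫ (α_ A B C).hom ▷ D := by
  have h (b : B) (c : C) : insr A b ▷ D ≫ insr (A ⊗ B) c ▷ D ≫ (α_ A B C).hom ▷ D =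
      insr A (B := B ⊗ C) (tmul b c) ▷ D := by
    rw [← comp_whiskerRight, ← comp_whiskerRight]
    congr 1
    ext a
    exact associator_hom_tmul a b c
  refine ext_insr_whiskerRight fun c => ext_insr_whiskerRight fun b => ?_
  rw [reassoc_of% h b c, insr_leg13, reassoc_of% insr_leg13 (leg13 B f) c,
    reassoc_of% insr_leg13 f b, h]

theorem associator_leg23 (f : (B ⊗ C) ⊗ D ⟶ (B ⊗ C) ⊗ D) :
    (α_ A B C).hom ▷ D ≫ leg23 A f = leg234 A f ≫ (α_ A B C).hom ▷ D := by
  simp only [leg234, Category.assoc, inv_hom_whiskerRight, Category.comp_id]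

theorem leg23_leftUnitor (f : A ⊗ B ⟶ A ⊗ B) :
    leg23 (𝟙_ Hilb.{u}) f ≫ (λ_ A).hom ▷ B = (λ_ A).hom ▷ B ≫ f := by
  simp only [leg23, leftUnitor_whiskerRight, Category.assoc, Iso.inv_hom_id_assoc,
    leftUnitor_naturality]

theorem leg13_rightUnitor (f : A ⊗ B ⟶ A ⊗ B) :
    leg13 (𝟙_ Hilb.{u}) f ≫ (ρ_ A).hom ▷ B = (ρ_ A).hom ▷ B ≫ f := by
  have h : (ρ_ A).hom = (β_ A (𝟙_ Hilb.{u})).hom ≫ (λ_ A).hom := rfl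
  rw [h, comp_whiskerRight, ← reassoc_of% leg13_eq_leg23 f, leg23_leftUnitor, Category.assoc]

/-- After an idle leg `H` is inserted, `a` passes through each of the four factors of the
commutator; for `S*` this uses unitarity of `S` and `S'`. -/
theorem braidZ_natural [Nontrivial H] {V : H ⊗ L ⟶ H ⊗ L} {S : K ⊗ H ⟶ K ⊗ H}
    {S' : K' ⊗ H ⟶ K' ⊗ H} (hS : IsUnitary S) (hS' : IsUnitary S') (h : HasBraiding V S)
    (h' : HasBraiding V S') {a : K ⟶ K'} (ha : S ≫ a ▷ H = a ▷ H ≫ S') :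
    braidZ V S ≫ a ▷ L = a ▷ L ≫ braidZ V S' := by
  have ha' := hS.dag_intertwines hS' ha
  refine leg13_injective (B := H) ?_
  have e : leg12 L S ≫ a ▷ H ▷ L = a ▷ H ▷ L ≫ leg12 L S' := by
    rw [← leg12_whiskerRight, leg12_comp, ha, ← leg12_comp]
  have e' : leg12 L (dag S) ≫ a ▷ H ▷ L = a ▷ H ▷ L ≫ leg12 L (dag S') := by
    rw [← leg12_whiskerRight, leg12_comp, ha', ← leg12_comp]
  rw [← leg13_comp, ← leg13_comp, leg13_whiskerRight, (braidZ_spec h).eq, (braidZ_spec h').eq]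
  simp only [Category.assoc]
  rw [← whiskerRight_leg23, reassoc_of% e', ← reassoc_of% whiskerRight_leg23 a (dag V),
    reassoc_of% e]

theorem braidZ_id [Nontrivial H] {V : H ⊗ L ⟶ H ⊗ L} (hV : IsUnitary V) (K : Hilb.{u}) :
    braidZ V (𝟙 (K ⊗ H)) = 𝟙 (K ⊗ L) :=
  braidZ_eq ⟨isUnitary_id _, by
    simp [leg12_id, leg13_id, dag_id, leg23_comp, hV.dag_comp, leg23_id]⟩

end Intertwiners

end Hilb

namespace BraidedMultUnitary


variable {H L : Hilb.{u}} {B : BraidedMultUnitary H L}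

/-! ### The monoidal category of representations -/

namespace Rep

theorem tensorS_whiskerRight {x x' : B.Rep} (f : x ⟶ x') (y : B.Rep) :
    tensorS x.S y.S ≫ f.map ▷ y.K ▷ H = f.map ▷ y.K ▷ H ≫ tensorS x'.S y.S := by
  simp only [tensorS, Category.assoc]
  rw [reassoc_of% whiskerRight_leg23 f.map y.S, ← leg13_whiskerRight, leg13_comp, leg13_comp,
    f.S_comm]

theorem tensorS_whiskerLeft (x : B.Rep) {y y' : B.Rep} (f : y ⟶ y') :
    tensorS x.S y.S ≫ (x.K ◁ f.map) ▷ H = (x.K ◁ f.map) ▷ H ≫ tensorS x.S y'.S := by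
  simp only [tensorS, Category.assoc]
  rw [← whiskerLeft_leg13, ← leg23_whiskerRight, reassoc_of% leg23_comp, f.S_comm, ← leg23_comp,
    Category.assoc]

theorem tensorT_whiskerRight {x x' : B.Rep} (f : x ⟶ x') (y : B.Rep) :
    tensorT B.V x.T y.S y.T ≫ f.map ▷ y.K ▷ L = f.map ▷ y.K ▷ L ≫ tensorT B.V x'.T y.S y.T := by
  have h : leg13 y.K x.T ≫ f.map ▷ y.K ▷ L = f.map ▷ y.K ▷ L ≫ leg13 y.K x'.T := by
    rw [← leg13_whiskerRight, leg13_comp, leg13_comp, f.T_comm]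
  simp only [tensorT_eq, Category.assoc]
  rw [reassoc_of% whiskerRight_leg23 f.map y.T, ← whiskerRight_leg23, reassoc_of% h,
    reassoc_of% whiskerRight_leg23 f.map (dag (braidZ B.V y.S))]

theorem tensorS_associator (x y z : B.Rep) :
    tensorS (tensorS x.S y.S) z.S ≫ (α_ x.K y.K z.K).hom ▷ H =
      (α_ x.K y.K z.K).hom ▷ H ≫ tensorS x.S (tensorS y.S z.S) := by
  simp only [tensorS, ← leg13_comp, ← leg23_comp, Category.assoc]
  rw [reassoc_of% associator_leg23, reassoc_of% associator_leg23, whiskerRight_leg13_associator,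
    leg234_leg13, leg234_leg23]

theorem tensorT_trivial_left {K : Hilb.{u}} (y : B.Rep) :
    tensorT B.V (𝟙 (K ⊗ L)) y.S y.T = leg23 K y.T := by
  have hy := (braidZ_spec y.isRep.S_braid).unitary
  rw [tensorT_eq, leg13_id, Category.id_comp, leg23_comp, hy.dag_comp, leg23_id, Category.comp_id]

theorem tensorS_trivial_left {K : Hilb.{u}} (y : B.Rep) :
    tensorS (𝟙 (K ⊗ H)) y.S = leg23 K y.S := by
  rw [tensorS, leg13_id, Category.comp_id]

theorem tensorS_trivial_right {K : Hilb.{u}} (x : B.Rep) :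
    tensorS x.S (𝟙 (K ⊗ H)) = leg13 K x.S := by
  rw [tensorS, leg23_id, Category.id_comp]

theorem tensorS_tensorHom {x x' y y' : B.Rep} (f : x ⟶ x') (g : y ⟶ y') :
    tensorS x.S y.S ≫ (f.map ⊗ₘ g.map) ▷ H = (f.map ⊗ₘ g.map) ▷ H ≫ tensorS x'.S y'.S := by
  rw [MonoidalCategory.tensorHom_def, comp_whiskerRight, Category.assoc,
    reassoc_of% tensorS_whiskerRight f y, tensorS_whiskerLeft]

variable [Nontrivial H]

theorem braidZ_comm {x y : B.Rep} (f : x ⟶ y) :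
    braidZ B.V x.S ≫ f.map ▷ L = f.map ▷ L ≫ braidZ B.V y.S :=
  braidZ_natural x.isRep.S_rep.unitary y.isRep.S_rep.unitary x.isRep.S_braid y.isRep.S_braid
    f.S_comm

theorem dag_braidZ_comm {x y : B.Rep} (f : x ⟶ y) :
    dag (braidZ B.V x.S) ≫ f.map ▷ L = f.map ▷ L ≫ dag (braidZ B.V y.S) :=
  (braidZ_spec x.isRep.S_braid).unitary.dag_intertwines (braidZ_spec y.isRep.S_braid).unitary
    (braidZ_comm f)

/-- Unlike for an arrow in the first factor, the braiding unitary changes with `y`, so its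
naturality is needed. -/
theorem tensorT_whiskerLeft (x : B.Rep) {y y' : B.Rep} (f : y ⟶ y') :
    tensorT B.V x.T y.S y.T ≫ (x.K ◁ f.map) ▷ L =
      (x.K ◁ f.map) ▷ L ≫ tensorT B.V x.T y'.S y'.T := by
  have h {g : y.K ⊗ L ⟶ y.K ⊗ L} {g' : y'.K ⊗ L ⟶ y'.K ⊗ L}
      (h : g ≫ f.map ▷ L = f.map ▷ L ≫ g') :
      leg23 x.K g ≫ (x.K ◁ f.map) ▷ L = (x.K ◁ f.map) ▷ L ≫ leg23 x.K g' := by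
    rw [← leg23_whiskerRight, leg23_comp, h, leg23_comp]
  simp only [tensorT_eq, Category.assoc]
  rw [h (braidZ_comm f), ← reassoc_of% whiskerLeft_leg13 f.map x.T,
    reassoc_of% h (dag_braidZ_comm f), reassoc_of% h f.T_comm]

theorem tensorT_tensorHom {x x' y y' : B.Rep} (f : x ⟶ x') (g : y ⟶ y') :
    tensorT B.V x.T y.S y.T ≫ (f.map ⊗ₘ g.map) ▷ L =
      (f.map ⊗ₘ g.map) ▷ L ≫ tensorT B.V x'.T y'.S y'.T := by
  rw [MonoidalCategory.tensorHom_def, comp_whiskerRight, Category.assoc,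
    reassoc_of% tensorT_whiskerRight f y, tensorT_whiskerLeft]

/-- An isomorphism of Hilbert spaces that intertwines the representations. -/
def isoMk {x y : B.Rep} (e : x.K ≅ y.K) (hS : x.S ≫ e.hom ▷ H = e.hom ▷ H ≫ y.S)
    (hT : x.T ≫ e.hom ▷ L = e.hom ▷ L ≫ y.T) : x ≅ y where
  hom := ⟨e.hom, hS, hT⟩
  inv := ⟨e.inv, by
      rw [← cancel_epi (e.hom ▷ H), ← reassoc_of% hS]; simp, by
      rw [← cancel_epi (e.hom ▷ L), ← reassoc_of% hT]; simp⟩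
  hom_inv_id := Rep.Hom.ext e.hom_inv_id
  inv_hom_id := Rep.Hom.ext e.inv_hom_id

/-- The tensor product of representations. -/
noncomputable def tensor (x y : B.Rep) : B.Rep :=
  ⟨x.K ⊗ y.K, tensorS x.S y.S, tensorT B.V x.T y.S y.T, B.isRep_tensor x y⟩

/-- Multiplicativity identifies the braiding unitary of `y ⊗ z` with a product of those of `y` and
`z`. The factors of `z` that meet in the middle cancel. -/
theorem tensorT_associator (x y z : B.Rep) :
    tensorT B.V (tensorT B.V x.T y.S y.T) z.S z.T ≫ (α_ x.K y.K z.K).hom ▷ L =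
      (α_ x.K y.K z.K).hom ▷ L ≫ tensorT B.V x.T (tensorS y.S z.S)
        (tensorT B.V y.T z.S z.T) := by
  have hy := (braidZ_spec y.isRep.S_braid).unitary
  have hz := (braidZ_spec z.isRep.S_braid).unitary
  simp only [tensorT_eq, braidZ_eq (B.isBraidingUnitary_tensor y z), Hilb.dag_comp, hy.dag_leg13,
    hz.dag_leg23, ← leg13_comp, ← leg23_comp, Category.assoc]
  simp only [reassoc_of% @associator_leg23, associator_leg23,
    reassoc_of% @whiskerRight_leg13_associator, leg234_leg13, leg234_leg23]
  have h : leg23 (x.K ⊗ y.K) (braidZ B.V z.S) ≫ leg23 (x.K ⊗ y.K) (dag (braidZ B.V z.S)) =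
      𝟙 _ := by rw [leg23_comp, hz.comp_dag, leg23_id]
  rw [reassoc_of% h]

theorem tensorT_trivial_right {K : Hilb.{u}} (x : B.Rep) :
    tensorT B.V x.T (𝟙 (K ⊗ H)) (𝟙 (K ⊗ L)) = leg13 K x.T := by
  rw [tensorT_eq, braidZ_id B.V_rep.unitary, dag_id, leg23_id, Category.id_comp,
    Category.comp_id, Category.id_comp]

/-- The tensor product of representations, with the structure of the category of Hilbert spaces. -/
@[reducible]
noncomputable def monoidalCategoryStruct : MonoidalCategoryStruct B.Rep where
  tensorObj := tensor
  whiskerLeft x _ _ f := ⟨x.K ◁ f.map, tensorS_whiskerLeft x f, tensorT_whiskerLeft x f⟩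
  whiskerRight f y := ⟨f.map ▷ y.K, tensorS_whiskerRight f y, tensorT_whiskerRight f y⟩
  tensorHom f g := ⟨f.map ⊗ₘ g.map, tensorS_tensorHom f g, tensorT_tensorHom f g⟩
  tensorUnit := B.trivial.obj (𝟙_ Hilb.{u})
  associator x y z := isoMk (α_ x.K y.K z.K) (tensorS_associator x y z) (tensorT_associator x y z)
  leftUnitor x := isoMk (λ_ x.K)
    ((congrArg (· ≫ _) (tensorS_trivial_left x)).trans (leg23_leftUnitor x.S))
    ((congrArg (· ≫ _) (tensorT_trivial_left x)).trans (leg23_leftUnitor x.T))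
  rightUnitor x := isoMk (ρ_ x.K)
    ((congrArg (· ≫ _) (tensorS_trivial_right x)).trans (leg13_rightUnitor x.S))
    ((congrArg (· ≫ _) (tensorT_trivial_right x)).trans (leg13_rightUnitor x.T))

attribute [local instance] monoidalCategoryStruct

/-- The monoidal category of representations. -/
@[reducible]
noncomputable def monoidalCategory : MonoidalCategory B.Rep where
  tensorHom_def f g := Rep.Hom.ext (MonoidalCategory.tensorHom_def f.map g.map)
  id_tensorHom_id x y := Rep.Hom.ext (MonoidalCategory.id_tensorHom_id x.K y.K)
  tensorHom_comp_tensorHom f₁ f₂ g₁ g₂ := Rep.Hom.ext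
    (MonoidalCategory.tensorHom_comp_tensorHom f₁.map f₂.map g₁.map g₂.map)
  whiskerLeft_id x y := Rep.Hom.ext (MonoidalCategory.whiskerLeft_id x.K y.K)
  id_whiskerRight x y := Rep.Hom.ext (MonoidalCategory.id_whiskerRight x.K y.K)
  associator_naturality f₁ f₂ f₃ := Rep.Hom.ext
    (MonoidalCategory.associator_naturality f₁.map f₂.map f₃.map)
  leftUnitor_naturality f := Rep.Hom.ext (MonoidalCategory.leftUnitor_naturality f.map)
  rightUnitor_naturality f := Rep.Hom.ext (MonoidalCategory.rightUnitor_naturality f.map)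
  pentagon w x y z := Rep.Hom.ext (MonoidalCategory.pentagon w.K x.K y.K z.K)
  triangle x y := Rep.Hom.ext (MonoidalCategory.triangle x.K y.K)

end Rep

end BraidedMultUnitary

/-! ### Spaces of intertwiners are weakly closed -/

namespace Hilb

variable {A B C : Hilb.{u}}

theorem IsUnitary.cancel_left {f : A ⟶ B} (hf : IsUnitary f) {g h : B ⟶ C}
    (e : f ≫ g = f ≫ h) : g = h := by
  rw [← Category.id_comp g, ← hf.dag_comp, Category.assoc, e, reassoc_of% hf.dag_comp]

theorem IsUnitary.cancel_right {f : B ⟶ C} (hf : IsUnitary f) {g h : A ⟶ B}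
    (e : g ≫ f = h ≫ f) : g = h := by
  rw [← Category.comp_id g, ← hf.comp_dag, ← Category.assoc, e, Category.assoc, hf.comp_dag,
    Category.comp_id]

/-- The slice of an operator on `A ⊗ C` by the vector functional of `c` and `c'`. -/
noncomputable def slice (S : A ⊗ C ⟶ A ⊗ C) (c c' : C) : A →L[ℂ] A :=
  (insr A c ≫ S ≫ dag (insr A c')).clm

/-- Both insertions and their adjoints pass through `a ⊗ 1`. The condition becomes a family of
linear equations in `a` itself. -/
theorem intertwines_iff_slice {S : A ⊗ C ⟶ A ⊗ C} {S' : B ⊗ C ⟶ B ⊗ C} {a : A ⟶ B} :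
    S ≫ a ▷ C = a ▷ C ≫ S' ↔
      ∀ c c', a.clm.comp (slice S c c') = (slice S' c c').comp a.clm := by
  have h (c c' : C) : insr A c ≫ (S ≫ a ▷ C) ≫ dag (insr B c') =
      (insr A c ≫ S ≫ dag (insr A c')) ≫ a := by
    simp only [Category.assoc, whiskerRight_dag_insr]
  have h' (c c' : C) : insr A c ≫ (a ▷ C ≫ S') ≫ dag (insr B c') =
      a ≫ insr B c ≫ S' ≫ dag (insr B c') := by
    simp only [Category.assoc, reassoc_of% insr_whiskerRight a c]
  constructor
  · intro e c c'
    have := h c c'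
    rw [e, h'] at this
    exact congrArg Hom.clm this.symm
  · intro e
    refine ext_dag_insr fun c' => ext_insr fun c => ?_
    rw [h, h']
    exact Hom.ext (e c c')

/-- The operators that intertwine two given operators on the tensor products with `C`. -/
noncomputable def intertwiners (S : A ⊗ C ⟶ A ⊗ C) (S' : B ⊗ C ⟶ B ⊗ C) :
    Submodule ℂ (A →L[ℂ] B) where
  carrier := {a | ∀ c c', a.comp (slice S c c') = (slice S' c c').comp a}
  zero_mem' c c' := by simp
  add_mem' {a b} ha hb c c' := by
    rw [ContinuousLinearMap.add_comp, ContinuousLinearMap.comp_add, ha, hb]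
  smul_mem' r a ha c c' := by
    rw [ContinuousLinearMap.smul_comp, ContinuousLinearMap.comp_smul, ha]

theorem mem_intertwiners {S : A ⊗ C ⟶ A ⊗ C} {S' : B ⊗ C ⟶ B ⊗ C} {a : A ⟶ B} :
    a.clm ∈ intertwiners S S' ↔ S ≫ a ▷ C = a ▷ C ≫ S' := intertwines_iff_slice.symm

/-- Slices multiply `a` on one side only. Tested on a vector and a functional, each equation
therefore compares two matrix coefficients of `a`, which are continuous in the weak operator
topology. -/
theorem isClosed_intertwiners (S : A ⊗ C ⟶ A ⊗ C) (S' : B ⊗ C ⟶ B ⊗ C) :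
    IsClosed {a : A →WOT[ℂ] B | a.toCLM ∈ intertwiners S S'} := by
  have h : {a : A →WOT[ℂ] B | a.toCLM ∈ intertwiners S S'} =
      ⋂ (c : C) (c' : C) (x : A) (φ : StrongDual ℂ B),
        {a | φ (a (slice S c c' x)) = (φ.comp (slice S' c c')) (a x)} := by
    ext a
    simp only [Set.mem_iInter, Set.mem_ofPred_eq]
    constructor
    · intro ha c c' x φ
      exact congrArg φ (DFunLike.congr_fun (ha c c') x)
    · intro ha c c'
      ext x
      exact (SeparatingDual.eq_iff_forall_dual_eq (R := ℂ)).2 fun φ => ha c c' x φ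
  rw [h]
  exact isClosed_iInter fun c => isClosed_iInter fun c' => isClosed_iInter fun x =>
    isClosed_iInter fun φ => isClosed_eq (ContinuousLinearMapWOT.continuous_dual_apply _ _)
      (ContinuousLinearMapWOT.continuous_dual_apply _ _)

end Hilb

/-! ### The Hilbert space tensor category axioms -/

namespace BraidedMultUnitary


variable {H L : Hilb.{u}} (B : BraidedMultUnitary H L)

theorem exists_hom_iff {x y : B.Rep} (a : x.K →L[ℂ] y.K) :
    (∃ f : x ⟶ y, (B.forget.map f).clm = a) ↔
      a ∈ intertwiners x.S y.S ⊓ intertwiners x.T y.T := by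
  constructor
  · rintro ⟨f, rfl⟩
    exact ⟨mem_intertwiners.2 f.S_comm, mem_intertwiners.2 f.T_comm⟩
  · rintro ⟨hS, hT⟩
    exact ⟨⟨⟨a⟩, (mem_intertwiners (a := ⟨a⟩)).1 hS, (mem_intertwiners (a := ⟨a⟩)).1 hT⟩, rfl⟩

theorem isConcreteWStar_forget : IsConcreteWStar B.forget where
  faithful := ⟨fun h => Rep.Hom.ext h⟩
  linear x y := ⟨intertwiners x.S y.S ⊓ intertwiners x.T y.T,
    Set.ext fun a => (B.exists_hom_iff a).symm⟩
  adjoint {x y} f := by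
    -- By unitarity an intertwiner of `S` and `S'` also intertwines their adjoints; the adjoint of
    -- that relation is the claim.
    have h {C : Hilb.{u}} {S : x.K ⊗ C ⟶ x.K ⊗ C} {S' : y.K ⊗ C ⟶ y.K ⊗ C} (hS : IsUnitary S)
        (hS' : IsUnitary S') (e : S ≫ f.map ▷ C = f.map ▷ C ≫ S') :
        S' ≫ dag f.map ▷ C = dag f.map ▷ C ≫ S := by
      have := congrArg dag (hS.dag_intertwines hS' e)
      simpa only [Hilb.dag_comp, dag_dag, dag_whiskerRight] using this.symm
    exact ⟨⟨dag f.map, h x.isRep.S_rep.unitary y.isRep.S_rep.unitary f.S_comm,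
      h x.isRep.T_unitary y.isRep.T_unitary f.T_comm⟩, rfl⟩
  weakly_closed x y := by
    have h : {a : B.forget.obj x →WOT[ℂ] B.forget.obj y |
          ∃ f : x ⟶ y, (B.forget.map f).clm = a.toCLM} =
        {a | a.toCLM ∈ intertwiners x.S y.S} ∩ {a | a.toCLM ∈ intertwiners x.T y.T} :=
      Set.ext fun a => B.exists_hom_iff a.toCLM
    rw [h]
    exact (isClosed_intertwiners _ _).inter (isClosed_intertwiners _ _)

variable {B}

theorem Rep.mk_congr {K : Hilb.{u}} {S S' : K ⊗ H ⟶ K ⊗ H} {T T' : K ⊗ L ⟶ K ⊗ L}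
    {h : B.IsRep S T} {h' : B.IsRep S' T'} (hS : S = S') (hT : T = T') :
    (⟨K, S, T, h⟩ : B.Rep) = ⟨K, S', T', h'⟩ := by
  subst hS hT
  rfl

theorem Rep.Hom.heq {x x' y y' : B.Rep} (hx : x = x') (hy : y = y') {f : x ⟶ y} {g : x' ⟶ y'}
    (h : HEq f.map g.map) : HEq f g := by
  subst hx hy
  exact heq_of_eq (Rep.Hom.ext (eq_of_heq h))

theorem Rep.eq_of_map_eq {x x' : B.Rep} (h : x.K = x'.K) (f : x ⟶ x')
    (hf : f.map = eqToHom h) : x = x' := by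
  obtain ⟨K, S, T, hx⟩ := x
  obtain ⟨K', S', T', hx'⟩ := x'
  dsimp only at h
  subst h
  have hS := f.S_comm
  have hT := f.T_comm
  rw [hf] at hS hT
  exact Rep.mk_congr (by simpa using hS) (by simpa using hT)

variable [Nontrivial H]

attribute [local instance] Rep.monoidalCategory

theorem Rep.trivial_tensor (K₁ K₂ : Hilb.{u}) :
    B.trivial.obj (K₁ ⊗ K₂) = B.trivial.obj K₁ ⊗ B.trivial.obj K₂ :=
  Rep.mk_congr ((Rep.tensorS_trivial_left (B.trivial.obj K₂)).trans leg23_id).symm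
    ((Rep.tensorT_trivial_left (B.trivial.obj K₂)).trans leg23_id).symm

theorem isStrictMonoidal_forget : IsStrictMonoidal B.forget where
  obj_tensor _ _ := rfl
  obj_unit := rfl
  map_tensor _ _ := HEq.rfl
  map_associator _ _ _ := HEq.rfl
  map_leftUnitor _ := HEq.rfl
  map_rightUnitor _ := HEq.rfl

theorem isStrictMonoidal_trivial : IsStrictMonoidal B.trivial where
  obj_tensor := Rep.trivial_tensor
  obj_unit := rfl
  map_tensor _ _ := Rep.Hom.heq (Rep.trivial_tensor _ _) (Rep.trivial_tensor _ _) HEq.rfl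
  map_associator _ _ _ := Rep.Hom.heq
    ((Rep.trivial_tensor _ _).trans (congrArg (· ⊗ _) (Rep.trivial_tensor _ _)))
    ((Rep.trivial_tensor _ _).trans (congrArg (_ ⊗ ·) (Rep.trivial_tensor _ _))) HEq.rfl
  map_leftUnitor _ := Rep.Hom.heq (Rep.trivial_tensor _ _) rfl HEq.rfl
  map_rightUnitor _ := Rep.Hom.heq (Rep.trivial_tensor _ _) rfl HEq.rfl

/-- All factors that come from `y` act trivially on the first leg and commute with `a` there. They
cancel, and the idle leg `y.K` is dropped. -/
theorem Rep.exists_hom_of_whiskerRight {x₁ x₂ y : B.Rep} [Nontrivial y.K] {a : x₁.K ⟶ x₂.K}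
    (f : x₁ ⊗ y ⟶ x₂ ⊗ y) (hf : f.map = a ▷ y.K) : ∃ g : x₁ ⟶ x₂, g.map = a := by
  have hy := y.isRep.S_rep.unitary
  have hZ := (braidZ_spec y.isRep.S_braid).unitary
  have hS : tensorS x₁.S y.S ≫ a ▷ y.K ▷ H = a ▷ y.K ▷ H ≫ tensorS x₂.S y.S := by
    rw [← hf]
    exact f.S_comm
  have hT : tensorT B.V x₁.T y.S y.T ≫ a ▷ y.K ▷ L =
      a ▷ y.K ▷ L ≫ tensorT B.V x₂.T y.S y.T := by
    rw [← hf]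
    exact f.T_comm
  refine ⟨⟨a, leg13_injective (B := y.K) ?_, leg13_injective (B := y.K) ?_⟩, rfl⟩
  · rw [← leg13_comp, ← leg13_comp, leg13_whiskerRight]
    refine hy.leg23.cancel_left (A := (x₁.K ⊗ y.K) ⊗ H) ?_
    simp only [tensorS, Category.assoc] at hS
    rw [hS, reassoc_of% whiskerRight_leg23 a y.S]
  · rw [← leg13_comp, ← leg13_comp, leg13_whiskerRight]
    simp only [tensorT_eq, Category.assoc] at hT
    rw [reassoc_of% whiskerRight_leg23 a y.T,
      reassoc_of% whiskerRight_leg23 a (dag (braidZ B.V y.S)), ← whiskerRight_leg23] at hT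
    have h := hZ.dag.leg23.cancel_left (y.isRep.T_unitary.leg23.cancel_left hT)
    refine hZ.leg23.cancel_right (B := (x₂.K ⊗ y.K) ⊗ L) ?_
    simpa only [Category.assoc] using h

/-- The order matters: the relation for `S` comes first, because it gives naturality of the braiding
unitary under `a`. Only then can the braiding factors be removed from the relation for `T`. -/
theorem Rep.exists_hom_of_whiskerLeft {x₁ x₂ y : B.Rep} [Nontrivial y.K] {a : x₁.K ⟶ x₂.K}
    (f : y ⊗ x₁ ⟶ y ⊗ x₂) (hf : f.map = y.K ◁ a) : ∃ g : x₁ ⟶ x₂, g.map = a := by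
  have hZ₁ := braidZ_spec x₁.isRep.S_braid
  have hZ₂ := braidZ_spec x₂.isRep.S_braid
  have hS : tensorS y.S x₁.S ≫ (y.K ◁ a) ▷ H = (y.K ◁ a) ▷ H ≫ tensorS y.S x₂.S := by
    rw [← hf]
    exact f.S_comm
  have hT : tensorT B.V y.T x₁.S x₁.T ≫ (y.K ◁ a) ▷ L =
      (y.K ◁ a) ▷ L ≫ tensorT B.V y.T x₂.S x₂.T := by
    rw [← hf]
    exact f.T_comm
  have ha : x₁.S ≫ a ▷ H = a ▷ H ≫ x₂.S := by
    refine leg23_injective (B := y.K) ?_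
    rw [← leg23_comp, ← leg23_comp, leg23_whiskerRight]
    refine y.isRep.S_rep.unitary.leg13.cancel_right ?_
    simp only [tensorS, Category.assoc] at hS ⊢
    rw [← hS, whiskerLeft_leg13]
  have hz := braidZ_natural x₁.isRep.S_rep.unitary x₂.isRep.S_rep.unitary x₁.isRep.S_braid
    x₂.isRep.S_braid ha
  have hz' := hZ₁.unitary.dag_intertwines hZ₂.unitary hz
  have lift {g : x₁.K ⊗ L ⟶ x₁.K ⊗ L} {g' : x₂.K ⊗ L ⟶ x₂.K ⊗ L}
      (h : g ≫ a ▷ L = a ▷ L ≫ g') :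
      leg23 y.K g ≫ (y.K ◁ a) ▷ L = (y.K ◁ a) ▷ L ≫ leg23 y.K g' := by
    rw [← leg23_whiskerRight, leg23_comp, h, leg23_comp]
  refine ⟨⟨a, ha, leg23_injective (B := y.K) ?_⟩, rfl⟩
  rw [← leg23_comp, ← leg23_comp, leg23_whiskerRight]
  simp only [tensorT_eq, Category.assoc] at hT
  rw [lift hz, ← reassoc_of% whiskerLeft_leg13 a y.T, reassoc_of% lift hz'] at hT
  refine hZ₂.unitary.dag.leg23.cancel_right (y.isRep.T_unitary.leg13.cancel_right
    (hZ₂.unitary.leg23.cancel_right ?_))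
  simpa only [Category.assoc] using hT

theorem isHilbertSpaceTensorCategory_rep : IsHilbertSpaceTensorCategory B.forget B.trivial where
  wstar := B.isConcreteWStar_forget
  for_strict := isStrictMonoidal_forget
  tau_strict := isStrictMonoidal_trivial
  tau_for := rfl
  eq_of_id _ _ h f hf := Rep.eq_of_map_eq h f hf
  cancel_right _ _ y _ hy := fun ⟨f, hf⟩ =>
    haveI : Nontrivial y.K := hy
    Rep.exists_hom_of_whiskerRight f (eq_of_heq hf)
  cancel_left _ _ y _ hy := fun ⟨f, hf⟩ =>
    haveI : Nontrivial y.K := hy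
    Rep.exists_hom_of_whiskerLeft f (eq_of_heq hf)

end BraidedMultUnitary

theorem mainTheorem9 {H L : Hilb.{u}} [Nontrivial H] (B : BraidedMultUnitary H L) :
    ∃ _ : MonoidalCategory B.Rep,
      (∀ x y : B.Rep, ∃ h : B.IsRep (tensorS x.S y.S) (tensorT B.V x.T y.S y.T),
        x ⊗ y = ⟨x.K ⊗ y.K, tensorS x.S y.S, tensorT B.V x.T y.S y.T, h⟩) ∧
      IsHilbertSpaceTensorCategory B.forget B.trivial :=
  ⟨BraidedMultUnitary.Rep.monoidalCategory, fun x y => ⟨B.isRep_tensor x y, rfl⟩,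
    BraidedMultUnitary.isHilbertSpaceTensorCategory_rep⟩
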